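/- Let $V, W$ be (real- or complex-valued) functions in the Kato class $\mathcal{K}_3$, i.e. $V, W \in L^1_{\mathrm{loc}}(\mathbb{R}^3)$ and $$\lim_{r \to 0}\ \sup_{x \in \mathbb{R}^3} \int_{|x-y|<r} \frac{|V(y)|}{|x-y|}\,\mathrm{d}y = 0,$$ and likewise for $W$. Suppose that $\operatorname{spt} V \subseteq U$ and $\operatorname{spt} W \subseteq U$ for some bounded open set $U \subseteq \mathbb{R}^3$ (here $\operatorname{spt}$ is the complement of the largest open set on which the function vanishes almost everywhere). For $z \in \mathbb{C}^3 \setminus\{0\}$ with $z \cdot z = \sum_j z_j^2 = 0$, let $\mathfrak{E}_z = \mathcal{F}^{-1}\big((|\xi|^2 + 2 z \cdot \xi)^{-1}\big)$, where $\mathcal{F}^{-1}$ is the inverse Fourier transform on tempered distributions, with kernel $(2\pi)^{-3}\mathrm{e}^{\mathrm{i} x\cdot\xi}$; it is a fundamental solution of $-\Delta + 2 z \cdot D$, $D = -\mathrm{i}\nabla$, and is given by a locally integrable function. Let $G_z u = \mathfrak{E}_z * u$. Then for every $\delta > 0$ there exists $s_0 > 0$, depending only on $V$, $W$ and $\delta$,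 such that for all $z \in \mathbb{C}^3$ with $|z| \ge s_0$ and $z \cdot z = 0$, the operator $|V|^{1/2} G_z |W|^{1/2}$, $f \mapsto |V|^{1/2}\,\big(\mathfrak{E}_z * (|W|^{1/2} f)\big)$, is well defined and bounded on $L^2(\mathbb{R}^3)$, and $$\big\| |V|^{1/2} G_z |W|^{1/2} \big\|_{L^2(\mathbb{R}^3) \to L^2(\mathbb{R}^3)} \le \delta.$$ -/

import Mathlib

open MeasureTheory Filter Topology
open scoped FourierTransform SchwartzMap Convolution ENNReal

noncomputable section

/-- Euclidean three-space `ℝ³`. -/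
abbrev R3 : Type := EuclideanSpace ℝ (Fin 3)

/-- `ℂ³` with the Hermitian norm `|z|² = ∑ |z_j|²`. -/
abbrev C3 : Type := EuclideanSpace ℂ (Fin 3)

/-- The complex Hilbert space `L²(ℝ³)`. -/
abbrev L2R3 : Type := Lp ℂ 2 (volume : Measure R3)

/-- The bilinear (not sesquilinear) square `z · z = ∑ z_j²`. -/
def bilinSq (z : C3) : ℂ := ∑ j, z j * z j

/-- The symbol `|ξ|² + 2 z · ξ` of the operator `-Δ + 2 z · D`, where `D = -i ∇`. -/
def conjSymbol (z : C3) (ξ : R3) : ℂ := ((‖ξ‖ ^ 2 : ℝ) : ℂ) + 2 * ∑ j, z j * (ξ j : ℂ)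

/-- The Kato class `𝒦₃`: locally integrable `V` with
`sup_x ∫_{|x-y|<r} |V(y)| / |x-y| dy → 0` as `r → 0+`. -/
def IsKato (V : R3 → ℂ) : Prop :=
  LocallyIntegrable V volume ∧
    Tendsto (fun r : ℝ => ⨆ x : R3, ∫⁻ y in Metric.ball x r, ‖V y‖ₑ / ‖x - y‖ₑ)
      (𝓝[>] 0) (𝓝 0)

/-- The support of a function defined up to null sets: the complement of the largest open set
on which it vanishes almost everywhere. -/
def essSupport (V : R3 → ℂ) : Set R3 :=
  {x | ∀ r > 0, ¬ ∀ᵐ y ∂(volume.restrict (Metric.ball x r)), V y = 0}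

/-- The locally integrable function `E` is, as a tempered distribution, the inverse Fourier
transform of `1 / (|ξ|² + 2 z · ξ)`, that is
`∫ E φ dx = ∫ (|ξ|² + 2 z · ξ)⁻¹ ((2π)⁻³ ∫ e^{i x · ξ} φ(x) dx) dξ` for Schwartz `φ`
(all integrals being absolutely convergent). The Fourier transform `𝓕⁻` below has the kernel
`e^{2π i x · η}`, so that the right-hand side is written in the variable `ξ = 2π η`.
Such an `E` is unique up to null sets and is a fundamental solution of `-Δ + 2 z · D`. -/
structure IsFundSol (z : C3) (E : R3 → ℂ) : Prop where
  locallyIntegrable : LocallyIntegrable E volume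
  integrable_mul : ∀ φ : 𝓢(R3, ℂ), Integrable (fun x => E x * φ x) volume
  integrable_symbol : ∀ φ : 𝓢(R3, ℂ),
    Integrable (fun η : R3 => (conjSymbol z ((2 * Real.pi) • η))⁻¹ * (𝓕⁻ φ) η) volume
  pairing : ∀ φ : 𝓢(R3, ℂ),
    ∫ x, E x * φ x = ∫ η : R3, (conjSymbol z ((2 * Real.pi) • η))⁻¹ * (𝓕⁻ φ) η

/-- The function `|V|^{1/2} f`. -/
def sqrtMul (V f : R3 → ℂ) (x : R3) : ℂ := (Real.sqrt ‖V x‖ : ℂ) * f x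

/-- The bounded operator `T` on `L²(ℝ³)` is `|V|^{1/2} G_z |W|^{1/2}`, where `G_z u = E * u` is
convolution with the function `E` whose Fourier transform is `1 / (|ξ|² + 2 z · ξ)`. The
convolution integral is required to converge absolutely at almost every point. -/
def IsSandwich (z : C3) (V W : R3 → ℂ) (T : L2R3 →L[ℂ] L2R3) : Prop :=
  ∃ E : R3 → ℂ, IsFundSol z E ∧ ∀ f : L2R3,
    (∀ᵐ x ∂(volume : Measure R3),
      ConvolutionExistsAt E (sqrtMul W f) x (ContinuousLinearMap.mul ℂ ℂ) volume) ∧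
    (T f : R3 → ℂ) =ᵐ[volume]
      sqrtMul V (E ⋆[ContinuousLinearMap.mul ℂ ℂ, volume] (sqrtMul W f))

end

/-!
Write `z = a + i b`. The condition `z · z = 0` says that `a ⊥ b` and `|a| = |b| = τ`, where
`τ = |z| / √2`. Completing the square gives
`|ξ|² + 2 z · ξ = |ξ + a|² - τ² + 2 i b · (ξ + a)`. In an orthonormal frame whose axis is `b / τ`,
with `ℝ³` written as `ℂ × ℝ` and `ξ + a = τ (v, s)`, this is `τ² (|v|² + (s + i)²)`. Hence the
fundamental solution is `E(x) = e^{-i a · x} τ F(τ x)`, with one function `F`, the inverse Fourier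
transform of `1 / (|v|² + (s + i)²)`, which depends neither on `z` nor on the frame
(`conjFundSol`, `isFundSol_conjFundSol`).

The function `F` is computed explicitly: integrate in `s` by one-dimensional Fourier inversion
(`integral_slice`), then in `v` by polar coordinates on the cylinder `|v| < n`, and let `n → ∞`.
The result is
`F(u, t) = (4π²)⁻¹ ∫_{-π/2}^{π/2} H(|u|, t, sin φ) dφ` with
`H(r, t, c) = e^{i r c} / (t - i r c) + e^t (|t| - t) / (t² + r² c²)` (`faddeevG`). Dominated
convergence with majorant `|t|^{-1/2} |u|^{-1/2}` turns this into the identity between `F` and the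
symbol, tested against functions of rapid decay (`integral_faddeevG_mul`).

Two properties of `F` carry the estimate.
* `|F(w)| ≤ 100 / |w|` (`norm_faddeevG_le`). The absolute value of `H` would lose a logarithm near
  `t = 0`; the bound uses that the imaginary part of `H` is odd in `c`, and one integration by parts
  in the conjugate Poisson kernel.
* `τ F(τ w) → 0` as `τ → ∞` for almost every `w`, by the Riemann-Lebesgue lemma
  (`tendsto_faddeevG_smul`). By dominated convergence `∫_{|w| < L} τ |F(τ w)| dw → 0` for every `L`
  (`tendsto_lintegral_faddeevG`); this quantity does not see the frame.

A potential `W` satisfying the hypotheses is integrable. In `∫ |E(x - y)| |W(y)| dy` the part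
`|x - y| < r` is small by the Kato condition, uniformly in `E`; away from it `|E| ≤ 100 / r`, so the
part where `|W| > n` is small by integrability; the part `|x - y| ≥ L` is at most
`(100 / L) ‖W‖_{L¹}`; and the rest is at most `n ∫_{|u| < L} |E|`, which is small for large `τ`. So
the integral is at most `δ` uniformly in `x` (`exists_lintegral_conjFundSol_le`), and likewise for
`V` with the reflected kernel. Schur's test then bounds the norm of `|V|^{1/2} G_z |W|^{1/2}` by `δ`
(`lintegral_schur_le`, `exists_isSandwich`).
-/

open Complex (I)

/-! ### The model symbol and its Fourier transform along the axis -/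

/-- The symbol `|v|² + (s + i)²` at `q = (v, s)`: up to the factor `τ²` it is `|ξ|² + 2 z · ξ` in a
frame adapted to `z`. It vanishes exactly on the circle `|v| = 1`, `s = 0`. -/
noncomputable def modelSymbol (q : ℂ × ℝ) : ℂ := ((‖q.1‖ : ℝ) : ℂ) ^ 2 + ((q.2 : ℂ) + I) ^ 2

/-- The inverse Fourier transform in `s` of `(ρ² + (s + i)²)⁻¹`, multiplied by `2 ρ`. It is
`e^{-t (ρ - 1)}` for `t > 0`, `ρ > 1`, it vanishes for `t > 0`, `ρ < 1`, and it is continuous at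
`t = 0`. -/
noncomputable def axialProfile (ρ t : ℝ) : ℝ :=
  Real.exp (t - ρ * |t|) - if ρ ≤ 1 then Real.exp (t - ρ * t) else 0

lemma axialProfile_of_pos {ρ t : ℝ} (ht : 0 ≤ t) :
    axialProfile ρ t = if ρ ≤ 1 then 0 else Real.exp (-(ρ - 1) * t) := by
  unfold axialProfile
  rw [abs_of_nonneg ht]
  split_ifs
  · simp
  · rw [sub_zero]; congr 1; ring

lemma axialProfile_of_nonpos {ρ t : ℝ} (ht : t ≤ 0) :
    axialProfile ρ t =
      Real.exp ((1 + ρ) * t) - if ρ ≤ 1 then Real.exp ((1 - ρ) * t) else 0 := by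
  unfold axialProfile
  rw [abs_of_nonpos ht]
  congr 2
  · ring
  · congr 1; ring_nf

lemma continuous_axialProfile (ρ : ℝ) : Continuous (axialProfile ρ) := by
  unfold axialProfile
  split_ifs <;> fun_prop

lemma integrable_axialProfile {ρ : ℝ} (h0 : 0 < ρ) (h1 : ρ ≠ 1) :
    Integrable (axialProfile ρ) := by
  have e1 : IntegrableOn (axialProfile ρ) (Set.Iic 0) := by
    have : IntegrableOn (fun t => Real.exp ((1 + ρ) * t) -
        if ρ ≤ 1 then Real.exp ((1 - ρ) * t) else 0) (Set.Iic 0) := by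
      refine (integrableOn_exp_mul_Iic (by linarith) 0).sub ?_
      split_ifs with h
      · exact integrableOn_exp_mul_Iic (by linarith [lt_of_le_of_ne h h1]) 0
      · exact integrableOn_zero
    exact this.congr_fun (fun t ht => (axialProfile_of_nonpos ht).symm) measurableSet_Iic
  have e2 : IntegrableOn (axialProfile ρ) (Set.Ioi 0) := by
    have : IntegrableOn (fun t => if ρ ≤ 1 then 0 else Real.exp (-(ρ - 1) * t)) (Set.Ioi 0) := by
      split_ifs with h
      · exact integrableOn_zero
      · exact integrableOn_exp_mul_Ioi (by linarith) 0
    exact this.congr_fun (fun t ht => (axialProfile_of_pos (le_of_lt ht)).symm) measurableSet_Ioi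
  rw [← integrableOn_univ, ← Set.Iic_union_Ioi (a := (0:ℝ))]
  exact e1.union e2

/-- The half-line integrals are combined by the factorization
`ρ² + (s + i)² = (ρ - 1 + i s) (1 + ρ - i s)`. -/
lemma integral_exp_mul_axialProfile {ρ : ℝ} (h0 : 0 < ρ) (h1 : ρ ≠ 1) (s : ℝ) :
    ∫ t : ℝ, Complex.exp (-(s * t * I)) * (axialProfile ρ t : ℂ) =
      2 * ρ / ((ρ : ℂ) ^ 2 + ((s : ℂ) + I) ^ 2) := by
  have hint : Integrable (fun t : ℝ => Complex.exp (-(s * t * I)) * (axialProfile ρ t : ℂ)) := by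
    refine (integrable_axialProfile h0 h1).ofReal.bdd_mul (c := 1) ?_ ?_
    · exact (by fun_prop : Continuous fun t : ℝ => Complex.exp (-(s * t * I))).aestronglyMeasurable
    · refine Filter.Eventually.of_forall fun t => ?_
      rw [show -((s:ℂ) * t * I) = ((-(s * t) : ℝ) : ℂ) * I by push_cast; ring,
        Complex.norm_exp_ofReal_mul_I]
  have key : ((ρ : ℂ) ^ 2 + ((s : ℂ) + I) ^ 2) =
      (ρ - 1 + s * I) * (1 + ρ - s * I) := by
    linear_combination ((s:ℂ)^2 + 1) * Complex.I_sq
  have n2 : (1 + ρ - s * I : ℂ) ≠ 0 := by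
    intro h; have := congrArg Complex.re h; simp at this; linarith
  rw [← intervalIntegral.integral_Iic_add_Ioi (b := 0) hint.integrableOn hint.integrableOn, key]
  rcases lt_or_gt_of_ne h1 with h | h
  · have n1 : (1 - ρ - s * I : ℂ) ≠ 0 := by
      intro h; have := congrArg Complex.re h; simp at this; linarith
    have n3 : (ρ - 1 + s * I : ℂ) ≠ 0 := by
      intro h; apply n1; linear_combination -h
    have a1 : ∫ t in Set.Ioi (0:ℝ), Complex.exp (-(s * t * I)) * (axialProfile ρ t : ℂ) = 0 := by
      rw [← integral_zero ℝ ℂ (μ := volume.restrict (Set.Ioi 0))]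
      refine setIntegral_congr_fun measurableSet_Ioi fun t ht => ?_
      simp [axialProfile_of_pos (le_of_lt (Set.mem_Ioi.1 ht)), h.le]
    have a2 : ∫ t in Set.Iic (0:ℝ), Complex.exp (-(s * t * I)) * (axialProfile ρ t : ℂ) =
        ∫ t in Set.Iic (0:ℝ), (Complex.exp ((1 + ρ - s * I) * t) -
          Complex.exp ((1 - ρ - s * I) * t)) := by
      refine setIntegral_congr_fun measurableSet_Iic fun t ht => ?_
      simp only [axialProfile_of_nonpos (Set.mem_Iic.1 ht), h.le, if_true]
      push_cast
      rw [mul_sub, ← Complex.exp_add, ← Complex.exp_add]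
      congr 2 <;> ring
    have g1 : 0 < (1 + ρ - s * I : ℂ).re := by simp; linarith
    have g2 : 0 < (1 - ρ - s * I : ℂ).re := by simp; linarith
    rw [a1, a2, integral_sub (integrableOn_exp_mul_complex_Iic g1 0)
      (integrableOn_exp_mul_complex_Iic g2 0),
      integral_exp_mul_complex_Iic g1, integral_exp_mul_complex_Iic g2]
    simp only [Complex.ofReal_zero, mul_zero, Complex.exp_zero, add_zero]
    field_simp
    ring
  · have n1 : (1 - ρ - s * I : ℂ) ≠ 0 := by
      intro h; have := congrArg Complex.re h; simp at this; linarith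
    have n3 : (ρ - 1 + s * I : ℂ) ≠ 0 := by
      intro h; have := congrArg Complex.re h; simp at this; linarith
    have a1 : ∫ t in Set.Ioi (0:ℝ), Complex.exp (-(s * t * I)) * (axialProfile ρ t : ℂ) =
        ∫ t in Set.Ioi (0:ℝ), Complex.exp (-(ρ - 1 + s * I) * t) := by
      refine setIntegral_congr_fun measurableSet_Ioi fun t ht => ?_
      simp only [axialProfile_of_pos (le_of_lt (Set.mem_Ioi.1 ht)), not_le.2 h, if_false]
      push_cast
      rw [← Complex.exp_add]
      congr 1; ring
    have a2 : ∫ t in Set.Iic (0:ℝ), Complex.exp (-(s * t * I)) * (axialProfile ρ t : ℂ) =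
        ∫ t in Set.Iic (0:ℝ), Complex.exp ((1 + ρ - s * I) * t) := by
      refine setIntegral_congr_fun measurableSet_Iic fun t ht => ?_
      simp only [axialProfile_of_nonpos (Set.mem_Iic.1 ht), not_le.2 h, if_false]
      push_cast
      rw [sub_zero, ← Complex.exp_add]
      congr 1; ring
    have g1 : 0 < (1 + ρ - s * I : ℂ).re := by simp; linarith
    have g2 : (-(ρ - 1 + s * I) : ℂ).re < 0 := by simp; linarith
    rw [a1, a2, integral_exp_mul_complex_Iic g1, integral_exp_mul_complex_Ioi g2]
    simp only [Complex.ofReal_zero, mul_zero, Complex.exp_zero]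
    field_simp
    ring

/-! ### Integrability of the reciprocal of the symbol -/

/-- The integrable factor in `s` of the majorant of `1 / |modelSymbol|`. At `s = 0` its value is the
junk value of `0 ^ (-1/2)`, so the majorization holds only for `s ≠ 0`. -/
noncomputable def axialMajorant (s : ℝ) : ℝ := 2 * (1 + |s|)⁻¹ * |s| ^ (-(1/2) : ℝ)

lemma modelSymbol_eq_mul (q : ℂ × ℝ) :
    modelSymbol q = ((‖q.1‖ - 1 : ℝ) + q.2 * I) * ((1 + ‖q.1‖ : ℝ) - q.2 * I) := by
  unfold modelSymbol
  push_cast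
  linear_combination ((q.2:ℂ)^2 + 1) * Complex.I_sq

lemma sqrt_mul_sqrt_le_norm (a b : ℝ) :
    |a| ^ (1/2 : ℝ) * |b| ^ (1/2 : ℝ) ≤ ‖(a + b * I : ℂ)‖ := by
  rw [Complex.norm_add_mul_I, ← Real.sqrt_eq_rpow, ← Real.sqrt_eq_rpow,
    ← Real.sqrt_mul (abs_nonneg _)]
  apply Real.sqrt_le_sqrt
  nlinarith [sq_nonneg (|a| - |b|), sq_abs a, sq_abs b, abs_nonneg a, abs_nonneg b,
    mul_nonneg (abs_nonneg a) (abs_nonneg b)]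

lemma norm_modelSymbol_inv_le {q : ℂ × ℝ} (h1 : ‖q.1‖ ≠ 1) (h2 : q.2 ≠ 0) :
    ‖(modelSymbol q)⁻¹‖ ≤ axialMajorant q.2 * |‖q.1‖ - 1| ^ (-(1/2) : ℝ) := by
  have b1 := sqrt_mul_sqrt_le_norm (‖q.1‖ - 1) q.2
  have b2 : (1 + |q.2|) / 2 ≤ ‖((1 + ‖q.1‖ : ℝ) - q.2 * I : ℂ)‖ := by
    have e1 := Complex.abs_re_le_norm ((1 + ‖q.1‖ : ℝ) - q.2 * I : ℂ)
    have e2 := Complex.abs_im_le_norm ((1 + ‖q.1‖ : ℝ) - q.2 * I : ℂ)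
    simp at e1 e2
    have := norm_nonneg q.1
    rw [abs_of_nonneg (by positivity)] at e1
    push_cast
    linarith
  have p1 : 0 < |‖q.1‖ - 1| := abs_pos.2 (sub_ne_zero.2 h1)
  have p2 : 0 < |q.2| := abs_pos.2 h2
  rw [modelSymbol_eq_mul, norm_inv, norm_mul, axialMajorant, Real.rpow_neg p1.le,
    Real.rpow_neg p2.le]
  calc _ ≤ ((|‖q.1‖ - 1| ^ (1/2:ℝ) * |q.2| ^ (1/2:ℝ)) * ((1 + |q.2|) / 2))⁻¹ := by
        apply inv_anti₀ (by positivity)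
        gcongr
    _ = _ := by field_simp

lemma integrableOn_Ioi_rpow_mul {a b : ℝ} (ha : -1 < a) (hab : a - b < -1) (hb : 0 ≤ b) :
    IntegrableOn (fun y : ℝ => y ^ a * (1 + y) ^ (-b)) (Set.Ioi 0) := by
  rw [← Set.Ioc_union_Ioi_eq_Ioi (zero_le_one' ℝ)]
  have hm : Measurable (fun y : ℝ => y ^ a * (1 + y) ^ (-b)) := by fun_prop
  refine IntegrableOn.union ?_ ?_
  · have := (intervalIntegral.intervalIntegrable_rpow' (a := 0) (b := 1) ha).1
    refine Integrable.mono' this hm.aestronglyMeasurable ?_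
    refine (ae_restrict_iff' measurableSet_Ioc).2 (Eventually.of_forall fun y hy => ?_)
    have hy0 := hy.1
    rw [Real.norm_of_nonneg (by positivity)]
    apply mul_le_of_le_one_right (by positivity)
    exact Real.rpow_le_one_of_one_le_of_nonpos (by linarith) (neg_nonpos.2 hb)
  · refine Integrable.mono' (integrableOn_Ioi_rpow_of_lt hab one_pos) hm.aestronglyMeasurable ?_
    refine (ae_restrict_iff' measurableSet_Ioi).2 (Eventually.of_forall fun y hy => ?_)
    have hy0 : (1:ℝ) < y := hy
    have : 0 < y := by linarith
    rw [Real.norm_of_nonneg (by positivity), sub_eq_add_neg, Real.rpow_add this]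
    gcongr ?_ * ?_
    exact Real.rpow_le_rpow_of_nonpos this (by linarith) (neg_nonpos.2 hb)

lemma integrable_norm_rpow_mul {E : Type*} [NormedAddCommGroup E] [NormedSpace ℝ E]
    [MeasurableSpace E] [Nontrivial E] (μ : Measure E) [FiniteDimensional ℝ E] [BorelSpace E]
    [μ.IsAddHaarMeasure] {a b : ℝ} (ha : -(Module.finrank ℝ E : ℝ) < a)
    (hab : a - b < -(Module.finrank ℝ E : ℝ)) (hb : 0 ≤ b) :
    Integrable (fun x : E => ‖x‖ ^ a * (1 + ‖x‖) ^ (-b)) μ := by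
  have hd : 1 ≤ Module.finrank ℝ E := Module.finrank_pos
  refine (integrable_fun_norm_addHaar μ (f := fun y => y ^ a * (1 + y) ^ (-b))).2 ?_
  refine (integrableOn_Ioi_rpow_mul (a := (Module.finrank ℝ E - 1 : ℕ) + a) (b := b)
    ?_ ?_ hb).congr_fun ?_ measurableSet_Ioi
  · rw [Nat.cast_sub hd]; push_cast; linarith
  · rw [Nat.cast_sub hd]; push_cast; linarith
  · intro y hy
    have hy : (0:ℝ) < y := hy
    simp only [smul_eq_mul]
    rw [Real.rpow_add hy, Real.rpow_natCast, mul_assoc]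

lemma integrable_axialMajorant : Integrable axialMajorant := by
  have := (integrable_norm_rpow_mul (E := ℝ) volume (a := -(1/2)) (b := 1)
    (by simp; norm_num) (by simp; norm_num) (by norm_num)).const_mul 2
  refine this.congr (Eventually.of_forall fun s => ?_)
  simp only [axialMajorant, Real.norm_eq_abs, Real.rpow_neg_one]
  ring

/-- The singularity `|‖v‖ - 1|^{-1/2}` on the unit circle is integrable in the plane. -/
lemma integrable_radial_rpow_mul {b : ℝ} (hb : 2 ≤ b) :
    Integrable (fun v : ℂ => |‖v‖ - 1| ^ (-(1/2) : ℝ) * (1 + ‖v‖) ^ (-b)) := by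
  refine (integrable_fun_norm_addHaar volume
    (f := fun y => |y - 1| ^ (-(1/2) : ℝ) * (1 + y) ^ (-b))).2 ?_
  have h1 : Integrable (fun y : ℝ => ‖y - 1‖ ^ (-(1/2):ℝ) * (1 + ‖y - 1‖) ^ (-1:ℝ)) :=
    (integrable_norm_rpow_mul (E := ℝ) volume (a := -(1/2)) (b := 1)
    (by simp; norm_num) (by simp; norm_num) (by norm_num)).comp_sub_right 1
  refine Integrable.mono' (h1.const_mul 2).integrableOn
    (by fun_prop : Measurable _).aestronglyMeasurable ?_
  refine (ae_restrict_iff' measurableSet_Ioi).2 (Eventually.of_forall fun y hy => ?_)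
  have hy : (0:ℝ) < y := hy
  simp only [Complex.finrank_real_complex, smul_eq_mul, Real.norm_eq_abs, Nat.add_one_sub_one,
    pow_one]
  rw [abs_mul, abs_mul, abs_of_pos hy, abs_of_nonneg (Real.rpow_nonneg (abs_nonneg _) _),
    abs_of_nonneg (Real.rpow_nonneg (by linarith) _), Real.rpow_neg_one]
  have k : y * (1 + y) ^ (-b) ≤ 2 * (1 + |y - 1|)⁻¹ := by
    calc y * (1 + y) ^ (-b) ≤ y * (1 + y) ^ (-2 : ℝ) := by
          gcongr
          linarith
      _ = y / (1 + y) ^ 2 := by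
          rw [Real.rpow_neg (by linarith)]; norm_cast
      _ ≤ 2 * (1 + |y - 1|)⁻¹ := by
          rw [← div_eq_mul_inv, div_le_div_iff₀ (by positivity) (by positivity)]
          have : |y - 1| ≤ y + 1 := by rw [abs_le]; constructor <;> linarith
          nlinarith
  calc _ = |y - 1| ^ (-(1/2):ℝ) * (y * (1 + y) ^ (-b)) := by ring
    _ ≤ |y - 1| ^ (-(1/2):ℝ) * (2 * (1 + |y - 1|)⁻¹) := by gcongr
    _ = _ := by ring

lemma measurable_modelSymbol : Measurable modelSymbol := by
  unfold modelSymbol; fun_prop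

lemma ae_norm_fst_ne_one : ∀ᵐ v : ℂ, ‖v‖ ≠ 1 := by
  have h : (volume : Measure ℂ) (Metric.sphere 0 1) = 0 :=
    Measure.addHaar_sphere _ _ _
  refine measure_mono_null (fun v hv => ?_) h
  simpa using hv

lemma ae_ne_zero_real : ∀ᵐ s : ℝ, s ≠ 0 := by
  simp [ae_iff, measure_singleton]

lemma ae_ne_zero_complex : ∀ᵐ s : ℂ, s ≠ 0 := by
  simp [ae_iff, measure_singleton]

lemma ae_prod_of_ae {P : ℂ → Prop} {Q : ℝ → Prop} (hP : ∀ᵐ v : ℂ, P v) (hQ : ∀ᵐ s : ℝ, Q s) :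
    ∀ᵐ q : ℂ × ℝ, P q.1 ∧ Q q.2 := by
  have h1 : ∀ᵐ q : ℂ × ℝ, P q.1 := Measure.quasiMeasurePreserving_fst.ae hP
  have h2 : ∀ᵐ q : ℂ × ℝ, Q q.2 := Measure.quasiMeasurePreserving_snd.ae hQ
  exact h1.and h2

lemma ae_norm_modelSymbol_inv_le :
    ∀ᵐ q : ℂ × ℝ, ‖(modelSymbol q)⁻¹‖ ≤ axialMajorant q.2 * |‖q.1‖ - 1| ^ (-(1/2) : ℝ) := by
  filter_upwards [ae_prod_of_ae ae_norm_fst_ne_one ae_ne_zero_real] with q hq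
  exact norm_modelSymbol_inv_le hq.1 hq.2

lemma integrable_modelSymbol_inv_mul {g : ℂ × ℝ → ℂ} (hg : AEStronglyMeasurable g)
    {C : ℝ} (hC : ∀ q, ‖g q‖ ≤ C * (1 + ‖q.1‖) ^ (-2 : ℝ)) :
    Integrable (fun q => (modelSymbol q)⁻¹ * g q) := by
  have h := (integrable_radial_rpow_mul le_rfl).mul_prod integrable_axialMajorant
  refine Integrable.mono' (h.const_mul C)
    (measurable_modelSymbol.inv.aestronglyMeasurable.mul hg) ?_
  filter_upwards [ae_norm_modelSymbol_inv_le] with q hq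
  rw [norm_mul]
  have h1 := hC q
  have h2 : 0 ≤ axialMajorant q.2 * |‖q.1‖ - 1| ^ (-(1/2) : ℝ) := (norm_nonneg _).trans hq
  calc _ ≤ (axialMajorant q.2 * |‖q.1‖ - 1| ^ (-(1/2) : ℝ)) * (C * (1 + ‖q.1‖) ^ (-2 : ℝ)) := by
        gcongr
    _ = _ := by ring

/-- The solid cylinder `|v| < n`. On it `1 / modelSymbol` is integrable, without any cut-off in
`s`. -/
def solidCylinder (n : ℕ) : Set (ℂ × ℝ) := Metric.ball 0 n ×ˢ Set.univ

lemma measurableSet_solidCylinder (n : ℕ) : MeasurableSet (solidCylinder n) :=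
  measurableSet_ball.prod MeasurableSet.univ

lemma integrableOn_modelSymbol_inv (n : ℕ) :
    IntegrableOn (fun q => (modelSymbol q)⁻¹) (solidCylinder n) := by
  rw [← integrable_indicator_iff (measurableSet_solidCylinder n)]
  have h := integrable_modelSymbol_inv_mul (g := (solidCylinder n).indicator 1)
    (C := (1 + n) ^ (2 : ℝ))
    (stronglyMeasurable_one.indicator (measurableSet_solidCylinder n)).aestronglyMeasurable ?_
  · refine h.congr (Eventually.of_forall fun q => ?_)
    by_cases hq : q ∈ solidCylinder n <;> simp [hq]
  · intro q
    by_cases hq : q ∈ solidCylinder n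
    · have h1 : ‖q.1‖ ≤ n := by
        have := hq.1
        simp at this
        exact this.le
      have : 0 ≤ ‖q.1‖ := norm_nonneg _
      simp only [hq, Set.indicator_of_mem, Pi.one_apply, norm_one]
      rw [Real.rpow_neg (by positivity), ← div_eq_mul_inv, one_le_div (by positivity)]
      gcongr
    · simp only [hq, not_false_iff, Set.indicator_of_notMem, norm_zero]
      positivity

lemma integrable_modelSymbol_slice_inv {ρ : ℝ} (h0 : 0 < ρ) (h1 : ρ ≠ 1) :
    Integrable (fun s : ℝ => ((ρ : ℂ) ^ 2 + ((s : ℂ) + I) ^ 2)⁻¹) := by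
  refine Integrable.mono' (integrable_axialMajorant.mul_const (|ρ - 1| ^ (-(1/2) : ℝ)))
    (by fun_prop : Measurable _).aestronglyMeasurable ?_
  filter_upwards [ae_ne_zero_real] with s hs
  have := norm_modelSymbol_inv_le (q := ((ρ : ℂ), s)) (by simpa [abs_of_pos h0] using h1) hs
  simpa [modelSymbol, abs_of_pos h0] using this

/-! ### Integration along the axis -/

/-- The inverse Fourier transform of the symbol along the axis, by Fourier inversion. The case
`ρ = 1` is excluded because the integrand is then not integrable at `s = 0`. -/
lemma integral_slice {ρ : ℝ} (h0 : 0 < ρ) (h1 : ρ ≠ 1) (t : ℝ) :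
    ∫ s : ℝ, ((ρ : ℂ) ^ 2 + ((s : ℂ) + I) ^ 2)⁻¹ * Complex.exp (s * t * I) =
      Real.pi / ρ * axialProfile ρ t := by
  have hρ : (ρ : ℂ) ≠ 0 := by exact_mod_cast h0.ne'
  set m : ℝ → ℂ := fun t => (axialProfile ρ t : ℂ) with hm
  have hF : 𝓕 m = fun ξ : ℝ => 2 * ρ * ((ρ : ℂ) ^ 2 + (((2 * Real.pi * ξ : ℝ) : ℂ) + I) ^ 2)⁻¹ := by
    funext ξ
    rw [Real.fourier_real_eq_integral_exp_smul, ← div_eq_mul_inv,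
      ← integral_exp_mul_axialProfile h0 h1]
    refine integral_congr_ae (Eventually.of_forall fun t => ?_)
    simp only [hm, smul_eq_mul]
    congr 2
    push_cast; ring
  have hFi : Integrable (𝓕 m) := by
    rw [hF]
    exact ((integrable_modelSymbol_slice_inv h0 h1).comp_mul_left'
      (R := 2 * Real.pi) (by positivity)).const_mul _
  have h := Continuous.fourierInv_fourier_eq
    (Complex.continuous_ofReal.comp (continuous_axialProfile ρ))
    (integrable_axialProfile h0 h1).ofReal hFi
  have h := congrFun h t
  rw [Real.fourierInv_eq'] at h
  have e : ∫ v : ℝ, Complex.exp ((2 * Real.pi * inner ℝ v t : ℝ) * I) • 𝓕 m v =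
      ∫ v : ℝ, (fun s : ℝ => 2 * ρ * (((ρ : ℂ) ^ 2 + ((s : ℂ) + I) ^ 2)⁻¹
        * Complex.exp (s * t * I))) (2 * Real.pi * v) := by
    refine integral_congr_ae (Eventually.of_forall fun v => ?_)
    simp only [hF, smul_eq_mul]
    rw [show (2 * Real.pi * inner ℝ v t : ℝ) = 2 * Real.pi * v * t by simp; ring]
    push_cast
    ring_nf
  have e' : ∫ v : ℝ, Complex.exp ((2 * Real.pi * inner ℝ v t : ℝ) * I) • 𝓕 m v = m t := h
  rw [e, Measure.integral_comp_mul_left (fun s : ℝ => 2 * ρ * (((ρ : ℂ) ^ 2 + ((s : ℂ) + I) ^ 2)⁻¹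
        * Complex.exp (s * t * I))) (2 * Real.pi), integral_const_mul,
        abs_of_pos (by positivity)] at e'
  have hpi : (Real.pi : ℂ) ≠ 0 := by exact_mod_cast Real.pi_ne_zero
  rw [show (axialProfile ρ t : ℂ) = m t from rfl, ← e', Complex.real_smul]
  generalize ∫ a : ℝ, ((ρ : ℂ) ^ 2 + ((a : ℂ) + I) ^ 2)⁻¹ * Complex.exp (a * t * I) = J
  push_cast
  field_simp

/-- The density `H(r, t, c)` whose mean over `c = sin φ` is the model fundamental solution at a point
of height `t` and distance `r` from the axis. -/
noncomputable def faddeevDensity (r t c : ℝ) : ℂ :=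
  Complex.exp (r * c * I) / (t - r * c * I) +
    ((Real.exp t * (|t| - t) / (t ^ 2 + (r * c) ^ 2) : ℝ) : ℂ)

/-- The analogue of `faddeevDensity` for the symbol cut off to the cylinder `|v| < n`. -/
noncomputable def truncDensity (n : ℕ) (r t c : ℝ) : ℂ :=
  ∫ ρ in (0:ℝ)..n, (axialProfile ρ t : ℂ) * Complex.exp (ρ * (r * c) * I)

lemma ofReal_sub_mul_I_ne_zero {t : ℝ} (ht : t ≠ 0) (x : ℝ) : (t - x * I : ℂ) ≠ 0 := by
  intro h
  exact ht (by simpa using congrArg Complex.re h)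

/-- For `n ≥ 1` the jump of `axialProfile` at `ρ = 1` lies in the range of integration, and the cut-off
only contributes a term which is exponentially small in `n`. -/
lemma truncDensity_eq {n : ℕ} (hn : 1 ≤ n) {r t c : ℝ} (ht : t ≠ 0) :
    truncDensity n r t c = faddeevDensity r t c -
      Complex.exp (t - (|t| - r * c * I) * n) / (|t| - r * c * I) := by
  have a1 := ofReal_sub_mul_I_ne_zero (abs_ne_zero.2 ht) (r * c)
  have a2 := ofReal_sub_mul_I_ne_zero ht (r * c)
  have hn' : (1:ℝ) ≤ n := by exact_mod_cast hn
  push_cast at a1 a2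
  have i1 : ∀ (y a b : ℝ), IntervalIntegrable (fun ρ : ℝ => Complex.exp (t) *
      Complex.exp (-(y - r * c * I) * ρ)) volume a b := fun y a b =>
    (by fun_prop : Continuous _).intervalIntegrable _ _
  have e1 : ∀ ρ : ℝ, (axialProfile ρ t : ℂ) * Complex.exp (ρ * (r * c) * I) =
      Complex.exp t * Complex.exp (-(|t| - r * c * I) * ρ) -
        {x : ℝ | x ≤ 1}.indicator (fun ρ : ℝ => Complex.exp t *
          Complex.exp (-(t - r * c * I) * ρ)) ρ := by
    intro ρ
    unfold axialProfile
    by_cases h : ρ ≤ 1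
    · simp only [h, if_true, Set.mem_ofPred_eq, Set.indicator_of_mem]
      push_cast
      rw [sub_mul, ← Complex.exp_add, ← Complex.exp_add, ← Complex.exp_add, ← Complex.exp_add]
      congr 2 <;> ring
    · simp only [h, if_false, Set.mem_ofPred_eq, Set.indicator_of_notMem, not_false_iff]
      push_cast
      rw [sub_zero, sub_zero, ← Complex.exp_add, ← Complex.exp_add]
      congr 1; ring
  unfold truncDensity
  simp_rw [e1]
  rw [intervalIntegral.integral_sub (i1 _ _ _), intervalIntegral.integral_indicator ⟨by simp, hn'⟩,
    intervalIntegral.integral_const_mul, intervalIntegral.integral_const_mul,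
    integral_exp_mul_complex (neg_ne_zero.2 a1), integral_exp_mul_complex (neg_ne_zero.2 a2)]
  · have x1 : Complex.exp (t - (|t| - r * c * I) * n) =
        Complex.exp t * Complex.exp (-(|t| - r * c * I) * n) := by
      rw [← Complex.exp_add]; congr 1; ring
    have x2 : Complex.exp t * Complex.exp (-(t - r * c * I)) = Complex.exp (r * c * I) := by
      rw [← Complex.exp_add]; congr 1; ring
    have x3 : (t - r * c * I : ℂ) * (t + r * c * I) = t ^ 2 + (r * c) ^ 2 := by
      linear_combination (-(r:ℂ)^2 * c^2) * Complex.I_sq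
    have x4 : (t + r * c * I : ℂ) ≠ 0 := by
      have := ofReal_sub_mul_I_ne_zero ht (-(r * c))
      push_cast at this
      simpa using this
    unfold faddeevDensity
    rw [x1, ← x2]
    push_cast
    rw [← x3]
    simp only [mul_zero, Complex.exp_zero, mul_one]
    rcases lt_or_gt_of_ne ht with h | h
    · rw [abs_of_neg h] at a1 ⊢
      push_cast at a1 ⊢
      have x5 : (-t - r * c * I : ℂ) = - (t + r * c * I) := by ring
      rw [x5]
      field_simp
      ring
    · rw [abs_of_pos h]
      field_simp
      ring
  · rw [intervalIntegrable_iff, Set.uIoc_of_le (by simp)]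
    refine IntegrableOn.indicator ?_ measurableSet_Iic
    have := i1 t 0 n
    rwa [intervalIntegrable_iff, Set.uIoc_of_le (by simp)] at this

/-! ### Polar coordinates in the transverse plane -/

lemma continuous_faddeevDensity {r t : ℝ} (ht : t ≠ 0) : Continuous (faddeevDensity r t) := by
  unfold faddeevDensity
  refine Continuous.add (Continuous.div (by fun_prop) (by fun_prop) fun c => ?_) ?_
  · have := ofReal_sub_mul_I_ne_zero ht (r * c)
    push_cast at this; exact this
  · refine Complex.continuous_ofReal.comp (Continuous.div (by fun_prop) (by fun_prop) fun c => ?_)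
    positivity

lemma continuous_truncDensity {n : ℕ} (hn : 1 ≤ n) {r t : ℝ} (ht : t ≠ 0) :
    Continuous (truncDensity n r t) := by
  have : truncDensity n r t = fun c => faddeevDensity r t c -
      Complex.exp (t - (|t| - r * c * I) * n) / (|t| - r * c * I) :=
    funext fun c => truncDensity_eq hn ht
  rw [this]
  refine (continuous_faddeevDensity ht).sub (Continuous.div (by fun_prop) (by fun_prop) fun c => ?_)
  have := ofReal_sub_mul_I_ne_zero (abs_ne_zero.2 ht) (r * c)
  push_cast at this; exact this

/-- A mean over the circle of a function of `cos (θ - α)` does not depend on `α` and covers the range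
of the sine twice. -/
lemma integral_cos_sub {E : Type*} [NormedAddCommGroup E] [NormedSpace ℝ E] {h : ℝ → E}
    (hh : Continuous h) (α : ℝ) :
    ∫ θ in (-Real.pi)..Real.pi, h (Real.cos (θ - α)) =
      (2:ℝ) • ∫ φ in (-(Real.pi / 2))..(Real.pi / 2), h (Real.sin φ) := by
  have hs : Continuous fun φ => h (Real.sin φ) := hh.comp Real.continuous_sin
  have p : Function.Periodic (fun φ => h (Real.sin φ)) (2 * Real.pi) := fun x => by
    simp only [Real.sin_add_two_pi]
  have e1 : ∫ θ in (-Real.pi)..Real.pi, h (Real.cos (θ - α)) =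
      ∫ θ in (-Real.pi)..Real.pi, (fun φ => h (Real.sin φ)) (θ + (Real.pi / 2 - α)) := by
    refine intervalIntegral.integral_congr fun θ _ => ?_
    simp only
    rw [← Real.sin_add_pi_div_two]
    congr 2; ring
  rw [e1, intervalIntegral.integral_comp_add_right (fun φ => h (Real.sin φ)),
    show Real.pi + (Real.pi / 2 - α) = (-Real.pi + (Real.pi / 2 - α)) + 2 * Real.pi by ring,
    p.intervalIntegral_add_eq _ (-(Real.pi / 2)),
    ← intervalIntegral.integral_add_adjacent_intervals (b := Real.pi / 2)
      (hs.intervalIntegrable _ _) (hs.intervalIntegrable _ _), two_smul]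
  congr 1
  have e2 := intervalIntegral.integral_comp_sub_left (a := Real.pi / 2)
    (b := -(Real.pi / 2) + 2 * Real.pi) (fun φ => h (Real.sin φ)) Real.pi
  simp only [Real.sin_pi_sub] at e2
  rw [e2]
  congr 1 <;> ring

lemma abs_axialProfile_le {ρ t : ℝ} (h : 0 ≤ ρ) :
    |axialProfile ρ t| ≤ Real.exp t + Real.exp (t + |t|) := by
  unfold axialProfile
  refine (abs_sub _ _).trans (add_le_add ?_ ?_)
  · rw [abs_of_pos (Real.exp_pos _)]
    apply Real.exp_le_exp.2
    nlinarith [abs_nonneg t]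
  · split_ifs with h1
    · rw [abs_of_pos (Real.exp_pos _)]
      apply Real.exp_le_exp.2
      nlinarith [neg_abs_le t, abs_nonneg t]
    · simp; positivity

lemma measurable_axialProfile_fst (t : ℝ) : Measurable fun ρ => axialProfile ρ t := by
  unfold axialProfile
  refine Measurable.sub (by fun_prop) (Measurable.ite measurableSet_Iic (by fun_prop) (by fun_prop))

/-- The transverse Fourier integral in polar coordinates. -/
lemma integral_ball_axialProfile {n : ℕ} (hn : 1 ≤ n) {t : ℝ} (ht : t ≠ 0) (u : ℂ) :
    ∫ v in Metric.ball (0:ℂ) n, Complex.exp ((v * (starRingEnd ℂ) u).re * I) *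
      (Real.pi / ‖v‖ * axialProfile ‖v‖ t : ℝ) =
    2 * Real.pi * ∫ φ in (-(Real.pi / 2))..(Real.pi / 2), truncDensity n ‖u‖ t (Real.sin φ) := by
  rw [← integral_indicator measurableSet_ball, ← Complex.integral_comp_polarCoord_symm]
  set g : ℝ × ℝ → ℂ := fun p => (Real.pi : ℂ) * ((axialProfile p.1 t : ℂ) *
    Complex.exp (p.1 * (‖u‖ * Real.cos (p.2 - u.arg) : ℝ) * I)) with hg
  have hpt : ∀ p ∈ polarCoord.target, p.1 • (Metric.ball (0:ℂ) n).indicator (fun v =>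
      Complex.exp ((v * (starRingEnd ℂ) u).re * I) *
      (Real.pi / ‖v‖ * axialProfile ‖v‖ t : ℝ)) (Complex.polarCoord.symm p) =
      (Set.Ioo (0:ℝ) n ×ˢ Set.Ioo (-Real.pi) Real.pi).indicator g p := by
    rintro ⟨ρ, θ⟩ ⟨h1, h2⟩
    have hρ : 0 < ρ := h1
    have hn' : ‖Complex.polarCoord.symm (ρ, θ)‖ = ρ := by
      rw [Complex.norm_polarCoord_symm, abs_of_pos hρ]
    have hre : (Complex.polarCoord.symm (ρ, θ) * (starRingEnd ℂ) u).re =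
        ρ * (‖u‖ * Real.cos (θ - u.arg)) := by
      have c1 := Complex.norm_mul_cos_arg u
      have c2 := Complex.norm_mul_sin_arg u
      rw [Complex.polarCoord_symm_apply, Real.cos_sub]
      simp [-Complex.ofReal_cos, -Complex.ofReal_sin]
      linear_combination (-ρ * Real.cos θ) * c1 - ρ * Real.sin θ * c2
    by_cases hb : ρ < n
    · rw [Set.indicator_of_mem (by simpa [abs_of_pos hρ] using hb),
        Set.indicator_of_mem (show (ρ, θ) ∈ Set.Ioo (0:ℝ) n ×ˢ Set.Ioo (-Real.pi) Real.pi from ⟨⟨hρ, hb⟩, h2⟩), hn', hre, hg]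
      have : (ρ : ℂ) ≠ 0 := by exact_mod_cast hρ.ne'
      simp only [Complex.real_smul]
      push_cast
      field_simp
    · rw [Set.indicator_of_notMem (by simpa [abs_of_pos hρ] using hb),
        Set.indicator_of_notMem (fun h => hb h.1.2), smul_zero]
  rw [setIntegral_congr_fun polarCoord.open_target.measurableSet hpt,
    setIntegral_indicator (measurableSet_Ioo.prod measurableSet_Ioo),
    Set.inter_eq_self_of_subset_right (show Set.Ioo (0:ℝ) n ×ˢ Set.Ioo (-Real.pi) Real.pi ⊆
      polarCoord.target from Set.prod_mono (fun x hx => hx.1) subset_rfl)]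
  have hgm : Measurable g := by
    have := measurable_axialProfile_fst t
    fun_prop
  have hgi : IntegrableOn g (Set.Ioo (0:ℝ) n ×ˢ Set.Ioo (-Real.pi) Real.pi)
      (volume.prod volume) := by
    refine Measure.integrableOn_of_bounded (M := Real.pi * (Real.exp t + Real.exp (t + |t|)))
      ?_ hgm.aestronglyMeasurable ?_
    · rw [Measure.prod_prod]; simp [ENNReal.mul_eq_top]
    · refine (ae_restrict_iff' (measurableSet_Ioo.prod measurableSet_Ioo)).2
        (Eventually.of_forall fun p hp => ?_)
      rw [hg, norm_mul, norm_mul, Complex.norm_real, Complex.norm_real, ← Complex.ofReal_mul,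
        Complex.norm_exp_ofReal_mul_I, mul_one, Real.norm_of_nonneg Real.pi_pos.le]
      gcongr
      exact abs_axialProfile_le hp.1.1.le
  have hgi' := hgi
  unfold IntegrableOn at hgi'
  rw [← Measure.prod_restrict] at hgi'
  rw [Measure.volume_eq_prod, ← Measure.prod_restrict, integral_prod_symm _ hgi']
  have e1 : ∀ θ, ∫ ρ in Set.Ioo (0:ℝ) n, g (ρ, θ) =
      Real.pi * truncDensity n ‖u‖ t (Real.cos (θ - u.arg)) := by
    intro θ
    rw [← integral_Ioc_eq_integral_Ioo, ← intervalIntegral.integral_of_le (by simp), truncDensity]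
    simp only [hg, intervalIntegral.integral_const_mul]
    congr 2
    push_cast
    rfl
  simp_rw [e1]
  rw [← integral_Ioc_eq_integral_Ioo, ← intervalIntegral.integral_of_le (by linarith [Real.pi_pos]),
    intervalIntegral.integral_const_mul, integral_cos_sub (continuous_truncDensity hn ht),
    Complex.real_smul]
  push_cast
  ring

/-! ### The model fundamental solution -/

/-- The Euclidean inner product on `ℂ × ℝ`, identified with `ℝ³`. -/
noncomputable def cylDot (q w : ℂ × ℝ) : ℝ := (q.1 * (starRingEnd ℂ) w.1).re + q.2 * w.2

/-- The model fundamental solution `F`, the inverse Fourier transform of `1 / modelSymbol`. The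
formula is meaningful for `w.2 ≠ 0`, hence almost everywhere. -/
noncomputable def faddeevG (w : ℂ × ℝ) : ℂ :=
  (1 / (4 * Real.pi ^ 2) : ℝ) *
    ∫ φ in (-(Real.pi / 2))..(Real.pi / 2), faddeevDensity ‖w.1‖ w.2 (Real.sin φ)

/-- The inverse Fourier transform, without the factor `(2π)⁻³`, of `1 / modelSymbol` cut off to a
cylinder. -/
noncomputable def truncKernel (n : ℕ) (w : ℂ × ℝ) : ℂ :=
  ∫ q in solidCylinder n, (modelSymbol q)⁻¹ * Complex.exp (cylDot q w * I)

lemma norm_exp_cylDot (q w : ℂ × ℝ) : ‖Complex.exp (cylDot q w * I)‖ = 1 :=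
  Complex.norm_exp_ofReal_mul_I _

lemma continuous_cylDot : Continuous fun p : (ℂ × ℝ) × (ℂ × ℝ) => cylDot p.1 p.2 := by
  unfold cylDot; fun_prop

lemma truncKernel_eq {n : ℕ} (hn : 1 ≤ n) {w : ℂ × ℝ} (hw : w.2 ≠ 0) :
    truncKernel n w = 2 * Real.pi *
      ∫ φ in (-(Real.pi / 2))..(Real.pi / 2), truncDensity n ‖w.1‖ w.2 (Real.sin φ) := by
  have hi : IntegrableOn (fun q => (modelSymbol q)⁻¹ * Complex.exp (cylDot q w * I))
      (solidCylinder n) (volume.prod volume) := by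
    refine Integrable.mul_bdd (c := 1) (integrableOn_modelSymbol_inv n) ?_ ?_
    · have : Continuous fun q => cylDot q w := by unfold cylDot; fun_prop
      exact (by fun_prop : Continuous _).aestronglyMeasurable
    · exact Eventually.of_forall fun q => (norm_exp_cylDot q w).le
  rw [truncKernel, Measure.volume_eq_prod]
  unfold solidCylinder at hi ⊢
  rw [setIntegral_prod _ hi, ← integral_ball_axialProfile hn hw]
  refine setIntegral_congr_ae measurableSet_ball ?_
  filter_upwards [ae_norm_fst_ne_one, ae_ne_zero_complex] with v h1 h0 _
  rw [Complex.ofReal_mul, Complex.ofReal_div, ← integral_slice (norm_pos_iff.2 h0) h1,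
    ← integral_const_mul, Measure.restrict_univ]
  refine integral_congr_ae (Eventually.of_forall fun s => ?_)
  simp only [modelSymbol, cylDot]
  push_cast
  rw [add_mul, Complex.exp_add]
  ring

lemma norm_sub_mul_I (t x : ℝ) : ‖(t - x * I : ℂ)‖ = Real.sqrt (t ^ 2 + x ^ 2) := by
  have := Complex.norm_add_mul_I t (-x)
  push_cast at this
  rw [neg_mul, ← sub_eq_add_neg] at this
  rw [this, neg_sq]

lemma norm_truncDensity_sub_le {n : ℕ} (hn : 1 ≤ n) {r t c : ℝ} (ht : t ≠ 0) :
    ‖truncDensity n r t c - faddeevDensity r t c‖ ≤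
      Real.exp (t - |t| * n) / Real.sqrt (t ^ 2 + (r * c) ^ 2) := by
  rw [truncDensity_eq hn ht, sub_sub_cancel_left, norm_neg, norm_div, Complex.norm_exp]
  have := norm_sub_mul_I |t| (r * c)
  push_cast at this
  rw [this, sq_abs]
  simp

lemma norm_faddeevDensity_le {r t c : ℝ} (ht : t ≠ 0) :
    ‖faddeevDensity r t c‖ ≤ 3 / Real.sqrt (t ^ 2 + (r * c) ^ 2) := by
  have hpos : 0 < t ^ 2 + (r * c) ^ 2 := by positivity
  have hs : 0 < Real.sqrt (t ^ 2 + (r * c) ^ 2) := Real.sqrt_pos.2 hpos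
  unfold faddeevDensity
  refine (norm_add_le _ _).trans ?_
  have h1 : ‖Complex.exp (r * c * I) / (t - r * c * I)‖ = 1 / Real.sqrt (t ^ 2 + (r * c) ^ 2) := by
    rw [norm_div, ← Complex.ofReal_mul, Complex.norm_exp_ofReal_mul_I, norm_sub_mul_I]
  have h2 : ‖((Real.exp t * (|t| - t) / (t ^ 2 + (r * c) ^ 2) : ℝ) : ℂ)‖ ≤
      2 / Real.sqrt (t ^ 2 + (r * c) ^ 2) := by
    rw [Complex.norm_real, Real.norm_of_nonneg
      (div_nonneg (mul_nonneg (Real.exp_pos _).le (sub_nonneg.2 (le_abs_self t))) hpos.le),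
      div_le_div_iff₀ hpos hs]
    have h3 : Real.exp t * (|t| - t) ≤ 2 * |t| := by
      rcases le_total 0 t with h | h
      · rw [abs_of_nonneg h]; simp [h]
      · have := Real.exp_le_one_iff.2 h
        rw [abs_of_nonpos h]
        nlinarith
    have h4 : |t| ≤ Real.sqrt (t ^ 2 + (r * c) ^ 2) :=
      Real.abs_le_sqrt (by nlinarith [sq_nonneg (r * c)])
    calc _ ≤ 2 * |t| * Real.sqrt (t ^ 2 + (r * c) ^ 2) := by gcongr
      _ ≤ 2 * Real.sqrt (t ^ 2 + (r * c) ^ 2) * Real.sqrt (t ^ 2 + (r * c) ^ 2) := by gcongr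
      _ = _ := by rw [mul_assoc, Real.mul_self_sqrt hpos.le]
  rw [h1]
  calc _ ≤ 1 / Real.sqrt (t ^ 2 + (r * c) ^ 2) + 2 / Real.sqrt (t ^ 2 + (r * c) ^ 2) := by gcongr
    _ = _ := by ring

lemma norm_truncDensity_le {n : ℕ} (hn : 1 ≤ n) {r t c : ℝ} (ht : t ≠ 0) :
    ‖truncDensity n r t c‖ ≤ 4 / Real.sqrt (t ^ 2 + (r * c) ^ 2) := by
  have h1 := norm_truncDensity_sub_le hn (r := r) (c := c) ht
  have h2 := norm_faddeevDensity_le (r := r) (c := c) ht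
  have h3 : Real.exp (t - |t| * n) ≤ 1 := by
    rw [Real.exp_le_one_iff]
    have : (1:ℝ) ≤ n := by exact_mod_cast hn
    nlinarith [le_abs_self t, abs_nonneg t]
  calc _ = ‖(truncDensity n r t c - faddeevDensity r t c) + faddeevDensity r t c‖ := by simp
    _ ≤ Real.exp (t - |t| * n) / Real.sqrt (t ^ 2 + (r * c) ^ 2) +
      3 / Real.sqrt (t ^ 2 + (r * c) ^ 2) := (norm_add_le _ _).trans (add_le_add h1 h2)
    _ ≤ 1 / Real.sqrt (t ^ 2 + (r * c) ^ 2) +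
      3 / Real.sqrt (t ^ 2 + (r * c) ^ 2) := by gcongr
    _ = _ := by ring

lemma tendsto_truncKernel {w : ℂ × ℝ} (hw : w.2 ≠ 0) :
    Tendsto (fun n => truncKernel n w) atTop (𝓝 ((2 * Real.pi) ^ 3 * faddeevG w)) := by
  have e : ((2 * Real.pi) ^ 3 * faddeevG w : ℂ) = 2 * Real.pi *
      ∫ φ in (-(Real.pi / 2))..(Real.pi / 2), faddeevDensity ‖w.1‖ w.2 (Real.sin φ) := by
    have hpi : (Real.pi : ℂ) ≠ 0 := by exact_mod_cast Real.pi_ne_zero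
    unfold faddeevG
    push_cast
    field_simp
    norm_num
  rw [e]
  have h : Tendsto (fun n => ∫ φ in (-(Real.pi / 2))..(Real.pi / 2),
      truncDensity n ‖w.1‖ w.2 (Real.sin φ)) atTop
      (𝓝 (∫ φ in (-(Real.pi / 2))..(Real.pi / 2), faddeevDensity ‖w.1‖ w.2 (Real.sin φ))) := by
    rw [tendsto_iff_norm_sub_tendsto_zero]
    have hlim : Tendsto (fun n : ℕ => Real.exp (w.2 - |w.2| * n) / |w.2| * |Real.pi / 2 - -(Real.pi / 2)|)
        atTop (𝓝 0) := by
      have : Tendsto (fun n : ℕ => w.2 - |w.2| * (n:ℝ)) atTop atBot := by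
        have h1 : Tendsto (fun n : ℕ => |w.2| * (n:ℝ)) atTop atTop :=
          tendsto_natCast_atTop_atTop.const_mul_atTop (abs_pos.2 hw)
        simpa [sub_eq_add_neg] using tendsto_atBot_add_const_left _ w.2 (tendsto_neg_atTop_atBot.comp h1)
      simpa using ((Real.tendsto_exp_atBot.comp this).div_const |w.2|).mul_const
        |Real.pi / 2 - -(Real.pi / 2)|
    refine squeeze_zero' (Eventually.of_forall fun _ => norm_nonneg _) ?_ hlim
    filter_upwards [eventually_ge_atTop 1] with n hn
    have c1 : Continuous fun φ => truncDensity n ‖w.1‖ w.2 (Real.sin φ) :=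
      (continuous_truncDensity hn hw).comp Real.continuous_sin
    have c2 : Continuous fun φ => faddeevDensity ‖w.1‖ w.2 (Real.sin φ) :=
      (continuous_faddeevDensity hw).comp Real.continuous_sin
    rw [← intervalIntegral.integral_sub (c1.intervalIntegrable _ _) (c2.intervalIntegrable _ _)]
    refine intervalIntegral.norm_integral_le_of_norm_le_const fun φ _ => ?_
    refine (norm_truncDensity_sub_le hn hw).trans ?_
    have : 0 < |w.2| := abs_pos.2 hw
    gcongr
    exact Real.abs_le_sqrt (by nlinarith [sq_nonneg (‖w.1‖ * Real.sin φ)])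
  refine (h.const_mul (2 * Real.pi : ℂ)).congr' ?_
  filter_upwards [eventually_ge_atTop 1] with n hn
  rw [truncKernel_eq hn hw]

lemma intervalIntegrable_abs_sin_rpow :
    IntervalIntegrable (fun φ => |Real.sin φ| ^ (-(1/2) : ℝ)) volume
      (-(Real.pi / 2)) (Real.pi / 2) := by
  have h0 : Integrable ((Set.Icc (-(Real.pi/2)) (Real.pi/2)).indicator
      fun φ : ℝ => |φ| ^ (-(1/2) : ℝ)) := by
    have h1 := (integrable_norm_rpow_mul (E := ℝ) volume (a := -(1/2)) (b := 1)
      (by simp; norm_num) (by simp; norm_num) (by norm_num)).const_mul (1 + Real.pi / 2)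
    refine h1.mono' (Measurable.indicator (by fun_prop) measurableSet_Icc).aestronglyMeasurable
      (Eventually.of_forall fun φ => ?_)
    by_cases h : φ ∈ Set.Icc (-(Real.pi/2)) (Real.pi/2)
    · rw [Set.indicator_of_mem h, Real.norm_of_nonneg (by positivity), Real.norm_eq_abs,
        Real.rpow_neg_one, mul_left_comm]
      refine le_mul_of_one_le_right (by positivity) ?_
      rw [← div_eq_mul_inv, one_le_div (by positivity)]
      have := abs_le.2 h
      linarith
    · rw [Set.indicator_of_notMem h, norm_zero]
      have := Real.pi_pos
      positivity
  have h1 := ((integrable_indicator_iff measurableSet_Icc).1 h0).const_mul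
    ((2 / Real.pi) ^ (-(1/2) : ℝ))
  rw [intervalIntegrable_iff, Set.uIoc_of_le (by linarith [Real.pi_pos])]
  refine Integrable.mono' (IntegrableOn.mono_set h1 Set.Ioc_subset_Icc_self)
    (by fun_prop : Measurable _).aestronglyMeasurable ?_
  refine (ae_restrict_iff' measurableSet_Ioc).2 ?_
  filter_upwards [ae_ne_zero_real] with φ h0 hφ
  have hp : 0 < |φ| := abs_pos.2 h0
  have := Real.pi_pos
  rw [Real.norm_of_nonneg (by positivity), ← Real.mul_rpow (by positivity) (by positivity)]
  refine Real.rpow_le_rpow_of_nonpos (by positivity) ?_ (by norm_num)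
  exact Real.mul_abs_le_abs_sin (abs_le.2 (Set.Ioc_subset_Icc_self hφ))

lemma inv_sqrt_le {a b : ℝ} (ha : a ≠ 0) (hb : b ≠ 0) :
    1 / Real.sqrt (a ^ 2 + b ^ 2) ≤ |a| ^ (-(1/2) : ℝ) * |b| ^ (-(1/2) : ℝ) := by
  have h := sqrt_mul_sqrt_le_norm a b
  have h1 : 0 < |a| := abs_pos.2 ha
  have h2 : 0 < |b| := abs_pos.2 hb
  rw [Complex.norm_add_mul_I] at h
  rw [Real.rpow_neg h1.le, Real.rpow_neg h2.le, ← mul_inv, ← one_div]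
  exact one_div_le_one_div_of_le (by positivity) h

/-- A bound uniform in `n` by a locally integrable function, which allows the passage to the limit
under the integral. -/
lemma exists_norm_truncKernel_le : ∃ C : ℝ, ∀ n : ℕ, 1 ≤ n → ∀ w : ℂ × ℝ, w.1 ≠ 0 → w.2 ≠ 0 →
    ‖truncKernel n w‖ ≤ C * (‖w.1‖ ^ (-(1/2) : ℝ) * |w.2| ^ (-(1/2) : ℝ)) := by
  refine ⟨2 * Real.pi * (4 * ∫ φ in (-(Real.pi / 2))..(Real.pi / 2), |Real.sin φ| ^ (-(1/2) : ℝ)),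
    fun n hn w h1 h2 => ?_⟩
  have hr : 0 < ‖w.1‖ := norm_pos_iff.2 h1
  rw [truncKernel_eq hn h2, norm_mul]
  have e : ‖(2 * Real.pi : ℂ)‖ = 2 * Real.pi := by
    rw [norm_mul, Complex.norm_real, Real.norm_of_nonneg Real.pi_pos.le]; simp
  rw [e, mul_assoc (2 * Real.pi)]
  refine mul_le_mul_of_nonneg_left ?_ (by positivity)
  have hint := intervalIntegrable_abs_sin_rpow.const_mul
    (4 * (‖w.1‖ ^ (-(1/2) : ℝ) * |w.2| ^ (-(1/2) : ℝ)))
  refine (intervalIntegral.norm_integral_le_of_norm_le (by linarith [Real.pi_pos]) ?_ hint).trans ?_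
  · filter_upwards [ae_ne_zero_real] with φ h0 hφ
    have hsin : Real.sin φ ≠ 0 := by
      intro h
      have := Real.mul_abs_le_abs_sin (abs_le.2 (Set.Ioc_subset_Icc_self hφ))
      rw [h, abs_zero] at this
      have h3 := abs_pos.2 h0
      have := mul_pos (show 0 < 2 / Real.pi by positivity) h3
      linarith
    refine (norm_truncDensity_le hn h2).trans ?_
    have := inv_sqrt_le h2 (mul_ne_zero hr.ne' hsin)
    rw [abs_mul, abs_of_pos hr, Real.mul_rpow hr.le (abs_nonneg _)] at this
    calc _ = 4 * (1 / Real.sqrt (w.2 ^ 2 + (‖w.1‖ * Real.sin φ) ^ 2)) := by ring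
      _ ≤ 4 * _ := mul_le_mul_of_nonneg_left this (by norm_num)
      _ = _ := by ring
  · rw [intervalIntegral.integral_const_mul]
    apply le_of_eq; ring

/-- `faddeevG` is the inverse Fourier transform of `1 / modelSymbol`, tested against `f`. -/
theorem integral_faddeevG_mul {f : ℂ × ℝ → ℂ} (hf : Integrable f)
    (hD : Integrable fun w : ℂ × ℝ => ‖w.1‖ ^ (-(1/2) : ℝ) * |w.2| ^ (-(1/2) : ℝ) * ‖f w‖)
    (hp : Integrable fun q => (modelSymbol q)⁻¹ * ∫ w, Complex.exp (cylDot q w * I) * f w) :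
    ∫ w, faddeevG w * f w = ((2 * Real.pi : ℂ) ^ 3)⁻¹ *
      ∫ q, (modelSymbol q)⁻¹ * ∫ w, Complex.exp (cylDot q w * I) * f w := by
  have hpi : (2 * Real.pi : ℂ) ^ 3 ≠ 0 := by
    exact_mod_cast (by positivity : (2 * Real.pi) ^ 3 ≠ 0)
  have hae : ∀ᵐ w : ℂ × ℝ, w.1 ≠ 0 ∧ w.2 ≠ 0 := ae_prod_of_ae ae_ne_zero_complex ae_ne_zero_real
  -- On a cylinder the reciprocal of the symbol is integrable, so Fubini's theorem applies.
  have swap : ∀ n : ℕ, ∫ q in solidCylinder n, (modelSymbol q)⁻¹ *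
      ∫ w, Complex.exp (cylDot q w * I) * f w = ∫ w, truncKernel n w * f w := by
    intro n
    have h0 : Integrable (fun p : (ℂ × ℝ) × (ℂ × ℝ) => (modelSymbol p.1)⁻¹ * f p.2)
        ((volume.restrict (solidCylinder n)).prod volume) :=
      Integrable.mul_prod (integrableOn_modelSymbol_inv n) hf
    have h1 : Integrable (Function.uncurry fun (q w : ℂ × ℝ) =>
        (modelSymbol q)⁻¹ * (Complex.exp (cylDot q w * I) * f w))
        ((volume.restrict (solidCylinder n)).prod volume) := by
      have hm : Continuous fun p : (ℂ × ℝ) × (ℂ × ℝ) => Complex.exp (cylDot p.1 p.2 * I) := by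
        have := continuous_cylDot
        fun_prop
      refine (h0.bdd_mul (c := 1) hm.aestronglyMeasurable
        (Eventually.of_forall fun p => (norm_exp_cylDot p.1 p.2).le)).congr
        (Eventually.of_forall fun p => ?_)
      simp only [Function.uncurry]
      ring
    calc _ = ∫ q in solidCylinder n, ∫ w, (modelSymbol q)⁻¹ * (Complex.exp (cylDot q w * I) * f w) := by
          simp_rw [integral_const_mul]
      _ = ∫ w, ∫ q in solidCylinder n, (modelSymbol q)⁻¹ * (Complex.exp (cylDot q w * I) * f w) :=
          integral_integral_swap h1
      _ = _ := by
          refine integral_congr_ae (Eventually.of_forall fun w => ?_)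
          simp only [truncKernel, ← mul_assoc, integral_mul_const]
  have lim1 : Tendsto (fun n : ℕ => ∫ q in solidCylinder n, (modelSymbol q)⁻¹ *
      ∫ w, Complex.exp (cylDot q w * I) * f w) atTop (𝓝 (∫ q, (modelSymbol q)⁻¹ *
      ∫ w, Complex.exp (cylDot q w * I) * f w)) := by
    have hU : ⋃ n, solidCylinder n = Set.univ := by
      refine Set.eq_univ_of_forall fun q => Set.mem_iUnion.2 ?_
      obtain ⟨n, hn⟩ := exists_nat_gt ‖q.1‖
      exact ⟨n, by simpa [solidCylinder] using hn⟩
    have := tendsto_setIntegral_of_monotone (f := fun q => (modelSymbol q)⁻¹ *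
      ∫ w, Complex.exp (cylDot q w * I) * f w) (μ := volume) measurableSet_solidCylinder
      (fun a b hab => Set.prod_mono (Metric.ball_subset_ball (by exact_mod_cast hab)) subset_rfl)
      hp.integrableOn
    rwa [hU, Measure.restrict_univ] at this
  obtain ⟨C, hC⟩ := exists_norm_truncKernel_le
  have lim2 : Tendsto (fun n : ℕ => ∫ w, truncKernel n w * f w) atTop
      (𝓝 (∫ w, ((2 * Real.pi) ^ 3 * faddeevG w) * f w)) := by
    refine tendsto_integral_filter_of_dominated_convergence
      (fun w => C * (‖w.1‖ ^ (-(1/2) : ℝ) * |w.2| ^ (-(1/2) : ℝ) * ‖f w‖)) ?_ ?_ (hD.const_mul C) ?_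
    · refine Eventually.of_forall fun n => AEStronglyMeasurable.mul ?_ hf.1
      have hm : StronglyMeasurable (Function.uncurry fun (w q : ℂ × ℝ) =>
          (modelSymbol q)⁻¹ * Complex.exp (cylDot q w * I)) := by
        have := continuous_cylDot.measurable.comp measurable_swap
        have h2 := measurable_modelSymbol
        have h3 : Measurable fun p : (ℂ × ℝ) × (ℂ × ℝ) => cylDot p.2 p.1 := this
        refine Measurable.stronglyMeasurable ?_
        simp only [Function.uncurry_def]
        fun_prop
      exact (hm.integral_prod_right (ν := volume.restrict (solidCylinder n))).aestronglyMeasurable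
    · filter_upwards [eventually_ge_atTop 1] with n hn
      filter_upwards [hae] with w hw
      rw [norm_mul, ← mul_assoc]
      exact mul_le_mul_of_nonneg_right (hC n hn w hw.1 hw.2) (norm_nonneg _)
    · filter_upwards [hae] with w hw
      exact (tendsto_truncKernel hw.2).mul_const _
  simp_rw [swap] at lim1
  have := tendsto_nhds_unique lim1 lim2
  rw [this, ← integral_const_mul]
  refine integral_congr_ae (Eventually.of_forall fun w => ?_)
  simp only
  field_simp

/-! ### The bound by the reciprocal of the norm -/

lemma integral_poisson_le_of_ne {t : ℝ} (ht : t ≠ 0) (r : ℝ) :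
    ∫ φ in (-(Real.pi / 2))..(Real.pi / 2), |t| / (t ^ 2 + (r * Real.sin φ) ^ 2) ≤
      Real.pi / |t| := by
  have hp : 0 < |t| := abs_pos.2 ht
  refine (Real.le_norm_self _).trans
    ((intervalIntegral.norm_integral_le_of_norm_le_const (a := -(Real.pi / 2)) (b := Real.pi / 2)
      (C := 1 / |t|) fun φ _ => ?_).trans ?_)
  · rw [Real.norm_of_nonneg (by positivity), div_le_div_iff₀ (by positivity) hp]
    nlinarith [sq_nonneg (r * Real.sin φ), sq_abs t]
  · rw [show Real.pi / 2 - -(Real.pi / 2) = Real.pi by ring, abs_of_pos Real.pi_pos]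
    apply le_of_eq; ring

/-- The sine is bounded below by a linear function, and the resulting Poisson integral is explicit. -/
lemma integral_poisson_le_of_pos {r : ℝ} (hr : 0 < r) {t : ℝ} (ht : t ≠ 0) :
    ∫ φ in (-(Real.pi / 2))..(Real.pi / 2), |t| / (t ^ 2 + (r * Real.sin φ) ^ 2) ≤
      Real.pi ^ 2 / (2 * r) := by
  have hp : 0 < |t| := abs_pos.2 ht
  have hpi := Real.pi_pos
  set k : ℝ := 2 * r / (Real.pi * |t|) with hk
  have hk0 : 0 < k := by positivity
  have h1 : ∫ φ in (-(Real.pi / 2))..(Real.pi / 2), |t| / (t ^ 2 + (r * Real.sin φ) ^ 2) ≤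
      ∫ φ in (-(Real.pi / 2))..(Real.pi / 2), (1 / |t|) * (1 + (φ * k) ^ 2)⁻¹ := by
    refine intervalIntegral.integral_mono_on (by linarith)
      (Continuous.intervalIntegrable (Continuous.div (by fun_prop) (by fun_prop)
        fun φ => by positivity) _ _)
      (Continuous.intervalIntegrable (continuous_const.mul (Continuous.inv₀ (by fun_prop)
        fun φ => by positivity)) _ _) fun φ hφ => ?_
    have hs := Real.mul_abs_le_abs_sin (abs_le.2 hφ)
    have h2 : (|t| * (φ * k)) ^ 2 ≤ (r * Real.sin φ) ^ 2 := by
      rw [sq_le_sq]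
      have : |t| * (φ * k) = r * (2 / Real.pi * φ) := by rw [hk]; field_simp
      rw [this, abs_mul, abs_mul, abs_mul, abs_of_pos (show 0 < 2 / Real.pi by positivity)]
      gcongr
    have e : (1 / |t|) * (1 + (φ * k) ^ 2)⁻¹ = |t| / (t ^ 2 + (|t| * (φ * k)) ^ 2) := by
      rw [mul_pow |t|, ← sq_abs t]; field_simp
    rw [e]
    gcongr
  refine h1.trans ?_
  have h3 := intervalIntegral.mul_integral_comp_mul_right (a := -(Real.pi / 2)) (b := Real.pi / 2)
    (f := fun x : ℝ => (1 + x ^ 2)⁻¹) k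
  rw [integral_inv_one_add_sq] at h3
  rw [intervalIntegral.integral_const_mul]
  have h4 : k * ∫ φ in (-(Real.pi / 2))..(Real.pi / 2), (1 + (φ * k) ^ 2)⁻¹ ≤ Real.pi := by
    rw [h3]
    linarith [Real.arctan_lt_pi_div_two (Real.pi / 2 * k),
      Real.neg_pi_div_two_lt_arctan (-(Real.pi / 2) * k)]
  calc _ = (Real.pi / (2 * r)) * (k * ∫ φ in (-(Real.pi / 2))..(Real.pi / 2),
          (1 + (φ * k) ^ 2)⁻¹) := by
        generalize ∫ φ in (-(Real.pi / 2))..(Real.pi / 2), (1 + (φ * k) ^ 2)⁻¹ = J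
        rw [hk]; field_simp
    _ ≤ (Real.pi / (2 * r)) * Real.pi := by gcongr
    _ = _ := by ring

lemma abs_conjPoisson_le {t : ℝ} (ht : t ≠ 0) (x : ℝ) :
    |x * Real.sin x / (t ^ 2 + x ^ 2)| ≤ 1 / (2 * |t|) := by
  have hp : 0 < |t| := abs_pos.2 ht
  rw [abs_div, abs_mul, abs_of_pos (show 0 < t ^ 2 + x ^ 2 by positivity),
    div_le_div_iff₀ (by positivity) (by positivity)]
  have := Real.abs_sin_le_one x
  calc |x| * |Real.sin x| * (2 * |t|) ≤ |x| * 1 * (2 * |t|) := by gcongr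
    _ ≤ _ := by nlinarith [sq_nonneg (|x| - |t|), sq_abs x, sq_abs t]

/-- A bound uniform in `r` and `t`, by an integration by parts with `1 - cos x` as primitive of
`sin x`: the factor `1 - cos x` compensates the growth of the derivative of `x / (t² + x²)` at
`0`. -/
lemma abs_integral_conjPoisson_le {r : ℝ} (hr : 0 < r) {t : ℝ} (ht : t ≠ 0) :
    |∫ x in (-r)..r, x * Real.sin x / (t ^ 2 + x ^ 2)| ≤ 2 + 4 * Real.pi := by
  have hpos : ∀ x : ℝ, 0 < t ^ 2 + x ^ 2 := fun x => by positivity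
  have hu : ∀ x : ℝ, HasDerivAt (fun x : ℝ => x / (t ^ 2 + x ^ 2))
      ((t ^ 2 - x ^ 2) / (t ^ 2 + x ^ 2) ^ 2) x := by
    intro x
    refine ((hasDerivAt_id' x).div ((hasDerivAt_pow 2 x).const_add (t ^ 2))
      (hpos x).ne').congr_deriv ?_
    push_cast
    ring
  have hv : ∀ x : ℝ, HasDerivAt (fun x : ℝ => 1 - Real.cos x) (Real.sin x) x := by
    intro x
    simpa only [neg_neg] using (Real.hasDerivAt_cos x).const_sub 1
  have hv0 : ∀ x, 0 ≤ 1 - Real.cos x := fun x => by linarith [Real.cos_le_one x]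
  have hv2 : ∀ x, 1 - Real.cos x ≤ 2 := fun x => by linarith [Real.neg_one_le_cos x]
  have hvx : ∀ x, 1 - Real.cos x ≤ x ^ 2 / 2 := fun x => by
    linarith [Real.one_sub_sq_div_two_le_cos (x := x)]
  have cu : Continuous fun x : ℝ => (t ^ 2 - x ^ 2) / (t ^ 2 + x ^ 2) ^ 2 :=
    Continuous.div (by fun_prop) (by fun_prop) fun x => (pow_pos (hpos x) 2).ne'
  have parts := intervalIntegral.integral_mul_deriv_eq_deriv_mul (a := -r) (b := r)
    (fun x _ => hu x) (fun x _ => hv x) (cu.intervalIntegrable _ _)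
    (Real.continuous_sin.intervalIntegrable _ _)
  have e : ∫ x in (-r)..r, x * Real.sin x / (t ^ 2 + x ^ 2) =
      ∫ x in (-r)..r, x / (t ^ 2 + x ^ 2) * Real.sin x :=
    intervalIntegral.integral_congr fun x _ => mul_div_right_comm _ _ _
  rw [e, parts]
  have b1 : |r / (t ^ 2 + r ^ 2) * (1 - Real.cos r)| ≤ 1 := by
    rw [abs_of_nonneg (mul_nonneg (div_nonneg hr.le (hpos r).le) (hv0 r)), div_mul_eq_mul_div,
      div_le_one (hpos r)]
    have : 1 - Real.cos r ≤ r := by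
      refine abs_le_of_sq_le_sq' ?_ hr.le |>.2
      nlinarith [hv0 r, hv2 r, hvx r]
    nlinarith [sq_nonneg t]
  have b2 : |∫ x in (-r)..r, (t ^ 2 - x ^ 2) / (t ^ 2 + x ^ 2) ^ 2 * (1 - Real.cos x)| ≤
      4 * Real.pi := by
    have hc : Continuous fun x : ℝ => 4 * (1 + x ^ 2)⁻¹ :=
      continuous_const.mul (Continuous.inv₀ (by fun_prop) fun x => by positivity)
    rw [← Real.norm_eq_abs]
    refine (intervalIntegral.norm_integral_le_of_norm_le (a := -r) (b := r) (by linarith)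
      (g := fun x : ℝ => 4 * (1 + x ^ 2)⁻¹) (Eventually.of_forall fun x _ => ?_)
      (hc.intervalIntegrable _ _)).trans ?_
    · rw [Real.norm_eq_abs, abs_mul, abs_of_nonneg (hv0 x), abs_div,
        abs_of_pos (pow_pos (hpos x) 2), ← div_eq_mul_inv, div_mul_eq_mul_div,
        div_le_div_iff₀ (pow_pos (hpos x) 2) (by positivity)]
      have h1 : |t ^ 2 - x ^ 2| ≤ t ^ 2 + x ^ 2 := by
        rw [abs_le]; constructor <;> nlinarith [sq_nonneg t, sq_nonneg x]
      have h2 : (1 - Real.cos x) * (1 + x ^ 2) ≤ 4 * (t ^ 2 + x ^ 2) := by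
        nlinarith [hvx x, mul_le_mul_of_nonneg_right (hv2 x) (sq_nonneg x), sq_nonneg t,
          sq_nonneg x]
      calc _ = |t ^ 2 - x ^ 2| * ((1 - Real.cos x) * (1 + x ^ 2)) := by ring
        _ ≤ (t ^ 2 + x ^ 2) * (4 * (t ^ 2 + x ^ 2)) :=
          mul_le_mul h1 h2 (mul_nonneg (hv0 x) (by positivity)) (hpos x).le
        _ = _ := by ring
    · rw [intervalIntegral.integral_const_mul, integral_inv_one_add_sq]
      linarith [Real.arctan_lt_pi_div_two r, Real.neg_pi_div_two_lt_arctan (-r)]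
  have b3 : |-r / (t ^ 2 + (-r) ^ 2) * (1 - Real.cos (-r))| ≤ 1 := by
    rw [Real.cos_neg, neg_sq, neg_div, neg_mul, abs_neg]; exact b1
  rw [abs_le] at *
  constructor <;> linarith [b1.1, b1.2, b2.1, b2.2, b3.1, b3.2]

lemma continuous_conjPoisson {t : ℝ} (ht : t ≠ 0) :
    Continuous fun x : ℝ => x * Real.sin x / (t ^ 2 + x ^ 2) :=
  Continuous.div (by fun_prop) (by fun_prop) fun x => by positivity

/-- With `1 = cos φ + (1 - cos φ)`, the first part becomes `abs_integral_conjPoisson_le` under the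
substitution `x = r sin φ`, and in the second part `1 - cos φ ≤ sin² φ` removes the singularity. -/
lemma abs_integral_conjPoisson_sin_le {r : ℝ} (hr : 0 < r) {t : ℝ} (ht : t ≠ 0) :
    |∫ φ in (-(Real.pi / 2))..(Real.pi / 2),
      (fun x => x * Real.sin x / (t ^ 2 + x ^ 2)) (r * Real.sin φ)| ≤ (2 + 5 * Real.pi) / r := by
  set G : ℝ → ℝ := fun x => x * Real.sin x / (t ^ 2 + x ^ 2) with hG
  have cG : Continuous G := continuous_conjPoisson ht
  have hpi := Real.pi_pos
  have split : ∫ φ in (-(Real.pi / 2))..(Real.pi / 2), G (r * Real.sin φ) =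
      (∫ φ in (-(Real.pi / 2))..(Real.pi / 2), (1 / r) * ((G ∘ fun φ => r * Real.sin φ) φ *
        (r * Real.cos φ))) +
      ∫ φ in (-(Real.pi / 2))..(Real.pi / 2), (1 - Real.cos φ) * G (r * Real.sin φ) := by
    rw [← intervalIntegral.integral_add (Continuous.intervalIntegrable (by fun_prop) _ _)
      (Continuous.intervalIntegrable (by fun_prop) _ _)]
    refine intervalIntegral.integral_congr fun φ _ => ?_
    simp only [Function.comp]
    field_simp
    ring
  have e1 : ∫ φ in (-(Real.pi / 2))..(Real.pi / 2), (1 / r) * ((G ∘ fun φ => r * Real.sin φ) φ *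
        (r * Real.cos φ)) = (1 / r) * ∫ x in (-r)..r, G x := by
    rw [intervalIntegral.integral_const_mul, intervalIntegral.integral_comp_mul_deriv
      (fun φ _ => (Real.hasDerivAt_sin φ).const_mul r) (by fun_prop) cG]
    simp
  have b2 : |∫ φ in (-(Real.pi / 2))..(Real.pi / 2), (1 - Real.cos φ) * G (r * Real.sin φ)| ≤
      Real.pi / r := by
    rw [← Real.norm_eq_abs]
    refine (intervalIntegral.norm_integral_le_of_norm_le_const (a := -(Real.pi / 2))
      (b := Real.pi / 2) (C := 1 / r) fun φ hφ => ?_).trans ?_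
    · rw [Set.uIoc_of_le (by linarith)] at hφ
      have hc : 0 ≤ Real.cos φ := Real.cos_nonneg_of_mem_Icc (Set.Ioc_subset_Icc_self hφ)
      have hc1 := Real.cos_le_one φ
      have h1 : 1 - Real.cos φ ≤ Real.sin φ ^ 2 := by nlinarith [Real.sin_sq_add_cos_sq φ]
      have hG1 : |r * Real.sin φ| * |G (r * Real.sin φ)| ≤ 1 := by
        have hs := Real.abs_sin_le_one (r * Real.sin φ)
        simp only [hG]
        generalize r * Real.sin φ = x at *
        rw [abs_div, abs_mul, abs_of_pos (show 0 < t ^ 2 + x ^ 2 by positivity), ← mul_div_assoc,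
          div_le_one (by positivity), ← mul_assoc]
        nlinarith [sq_abs x, sq_nonneg t, abs_nonneg x, mul_nonneg (abs_nonneg x) (abs_nonneg x)]
      have hs1 := Real.abs_sin_le_one φ
      rw [Real.norm_eq_abs, abs_mul, abs_of_nonneg (by linarith), le_div_iff₀ hr]
      rw [abs_mul, abs_of_pos hr] at hG1
      calc (1 - Real.cos φ) * |G (r * Real.sin φ)| * r
          ≤ Real.sin φ ^ 2 * |G (r * Real.sin φ)| * r := by gcongr
        _ = |Real.sin φ| * (r * |Real.sin φ| * |G (r * Real.sin φ)|) := by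
            rw [← sq_abs]; ring
        _ ≤ 1 * 1 := by gcongr
        _ = 1 := one_mul 1
    · rw [show Real.pi / 2 - -(Real.pi / 2) = Real.pi by ring, abs_of_pos Real.pi_pos]
      apply le_of_eq; ring
  have b1 := abs_integral_conjPoisson_le hr ht
  rw [split, e1]
  refine (abs_add_le _ _).trans ?_
  rw [abs_mul, abs_of_pos (by positivity : 0 < 1 / r)]
  calc _ ≤ 1 / r * (2 + 4 * Real.pi) + Real.pi / r := by gcongr
    _ = _ := by ring

lemma integral_odd_eq_zero {f : ℝ → ℝ} (hf : ∀ x, f (-x) = -f x) (a : ℝ) :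
    ∫ x in (-a)..a, f x = 0 := by
  have h := intervalIntegral.integral_comp_neg (a := -a) (b := a) f
  simp only [hf, neg_neg, intervalIntegral.integral_neg] at h
  linarith

/-- The imaginary part of the density is odd in `φ` and integrates to zero. -/
lemma integral_faddeevDensity {r t : ℝ} (ht : t ≠ 0) :
    ∫ φ in (-(Real.pi / 2))..(Real.pi / 2), faddeevDensity r t (Real.sin φ) =
    ((∫ φ in (-(Real.pi / 2))..(Real.pi / 2),
        (t * Real.cos (r * Real.sin φ) + Real.exp t * (|t| - t)) /
          (t ^ 2 + (r * Real.sin φ) ^ 2)) -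
      ∫ φ in (-(Real.pi / 2))..(Real.pi / 2),
      (fun x => x * Real.sin x / (t ^ 2 + x ^ 2)) (r * Real.sin φ) : ℝ) := by
  have hc : Continuous fun φ : ℝ => t ^ 2 + (r * Real.sin φ) ^ 2 := by fun_prop
  have hne : ∀ φ : ℝ, t ^ 2 + (r * Real.sin φ) ^ 2 ≠ 0 := fun φ => by positivity
  have c1 : Continuous fun φ : ℝ => (t * Real.cos (r * Real.sin φ) + Real.exp t * (|t| - t)) /
          (t ^ 2 + (r * Real.sin φ) ^ 2) := Continuous.div (by fun_prop) hc hne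
  have c2 : Continuous fun φ : ℝ => (fun x => x * Real.sin x / (t ^ 2 + x ^ 2)) (r * Real.sin φ) :=
    Continuous.div (by fun_prop) hc hne
  have c3 : Continuous fun φ : ℝ => (t * Real.sin (r * Real.sin φ) + r * Real.sin φ *
      Real.cos (r * Real.sin φ)) / (t ^ 2 + (r * Real.sin φ) ^ 2) :=
    Continuous.div (by fun_prop) hc hne
  have h0 : ∫ φ in (-(Real.pi / 2))..(Real.pi / 2), (t * Real.sin (r * Real.sin φ) +
      r * Real.sin φ * Real.cos (r * Real.sin φ)) / (t ^ 2 + (r * Real.sin φ) ^ 2) = 0 :=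
    integral_odd_eq_zero (fun φ => by simp; ring) _
  have e : ∀ φ : ℝ, faddeevDensity r t (Real.sin φ) =
      (((t * Real.cos (r * Real.sin φ) + Real.exp t * (|t| - t)) /
          (t ^ 2 + (r * Real.sin φ) ^ 2) -
        (fun x => x * Real.sin x / (t ^ 2 + x ^ 2)) (r * Real.sin φ) : ℝ) : ℂ) +
      (((t * Real.sin (r * Real.sin φ) + r * Real.sin φ *
        Real.cos (r * Real.sin φ)) / (t ^ 2 + (r * Real.sin φ) ^ 2) : ℝ) : ℂ) * I := by
    intro φ
    unfold faddeevDensity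
    rw [← Complex.ofReal_mul]
    generalize r * Real.sin φ = x at *
    have hx : (t ^ 2 + x ^ 2 : ℂ) ≠ 0 := by
      have : t ^ 2 + x ^ 2 ≠ 0 := by positivity
      exact_mod_cast this
    have hd := ofReal_sub_mul_I_ne_zero ht x
    have h1 : Complex.exp (x * I) / (t - x * I) = ((t * Complex.cos x - x * Complex.sin x) +
        (t * Complex.sin x + x * Complex.cos x) * I) / (t ^ 2 + x ^ 2) := by
      rw [Complex.exp_mul_I, div_eq_div_iff hd hx]
      linear_combination (Complex.cos x * x ^ 2 + x * Complex.sin x * t) * Complex.I_sq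
    rw [h1]
    push_cast
    ring
  simp_rw [e]
  rw [intervalIntegral.integral_add, intervalIntegral.integral_mul_const,
    intervalIntegral.integral_ofReal, intervalIntegral.integral_ofReal, h0,
    intervalIntegral.integral_sub (c1.intervalIntegrable _ _) (c2.intervalIntegrable _ _)]
  · simp
  · exact (Complex.continuous_ofReal.comp (c1.sub c2)).intervalIntegrable _ _
  · exact ((Complex.continuous_ofReal.comp c3).mul continuous_const).intervalIntegrable _ _

/-- The constant is not optimal. The two cases of the proof bound the integral by multiples of
`1 / |t|` and of `1 / r`. -/
lemma norm_integral_faddeevDensity_le {r t : ℝ} (hr : 0 ≤ r) (ht : t ≠ 0) :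
    ‖∫ φ in (-(Real.pi / 2))..(Real.pi / 2), faddeevDensity r t (Real.sin φ)‖ ≤
      100 / Real.sqrt (r ^ 2 + t ^ 2) := by
  have hp : 0 < |t| := abs_pos.2 ht
  have hpi := Real.pi_pos
  have hpi4 := Real.pi_le_four
  set P := ∫ φ in (-(Real.pi / 2))..(Real.pi / 2), |t| / (t ^ 2 + (r * Real.sin φ) ^ 2) with hP
  set Q := ∫ φ in (-(Real.pi / 2))..(Real.pi / 2),
      (fun x => x * Real.sin x / (t ^ 2 + x ^ 2)) (r * Real.sin φ) with hQ
  have hE : Real.exp t * (|t| - t) ≤ 2 * |t| := by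
    rcases le_total 0 t with h | h
    · rw [abs_of_nonneg h]; simp [h]
    · have := Real.exp_le_one_iff.2 h
      rw [abs_of_nonpos h]
      nlinarith
  have hE0 : 0 ≤ Real.exp t * (|t| - t) :=
    mul_nonneg (Real.exp_pos _).le (sub_nonneg.2 (le_abs_self t))
  have h1 : |∫ φ in (-(Real.pi / 2))..(Real.pi / 2),
        (t * Real.cos (r * Real.sin φ) + Real.exp t * (|t| - t)) /
          (t ^ 2 + (r * Real.sin φ) ^ 2)| ≤ 3 * P := by
    rw [hP, ← intervalIntegral.integral_const_mul]
    rw [← Real.norm_eq_abs]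
    refine intervalIntegral.norm_integral_le_of_norm_le (a := -(Real.pi / 2))
      (b := Real.pi / 2) (g := fun φ => 3 * (|t| / (t ^ 2 + (r * Real.sin φ) ^ 2))) (by linarith)
      (Eventually.of_forall fun φ _ => ?_) (Continuous.intervalIntegrable
        (continuous_const.mul (Continuous.div (by fun_prop) (by fun_prop)
          fun φ => by positivity)) _ _)
    have hd : 0 < t ^ 2 + (r * Real.sin φ) ^ 2 := by positivity
    rw [Real.norm_eq_abs, abs_div, abs_of_pos hd, ← mul_div_assoc]
    gcongr
    refine (abs_add_le _ _).trans ?_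
    rw [abs_mul, abs_of_nonneg hE0]
    have := Real.abs_cos_le_one (r * Real.sin φ)
    nlinarith
  have hX : ‖∫ φ in (-(Real.pi / 2))..(Real.pi / 2), faddeevDensity r t (Real.sin φ)‖ ≤
      3 * P + |Q| := by
    rw [integral_faddeevDensity ht, Complex.norm_real, Real.norm_eq_abs]
    exact (abs_sub _ _).trans (by gcongr)
  have hQt : |Q| ≤ Real.pi / (2 * |t|) := by
    rw [← Real.norm_eq_abs]
    refine (intervalIntegral.norm_integral_le_of_norm_le_const (a := -(Real.pi / 2))
      (b := Real.pi / 2) (C := 1 / (2 * |t|)) fun φ _ => abs_conjPoisson_le ht (r * Real.sin φ)).trans ?_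
    rw [show Real.pi / 2 - -(Real.pi / 2) = Real.pi by ring, abs_of_pos Real.pi_pos]
    apply le_of_eq; ring
  have bt : |t| * (3 * P + |Q|) ≤ 20 := by
    have h2 := integral_poisson_le_of_ne ht r
    calc |t| * (3 * P + |Q|) ≤ |t| * (3 * (Real.pi / |t|) + Real.pi / (2 * |t|)) := by gcongr
      _ = 7 / 2 * Real.pi := by field_simp; norm_num
      _ ≤ _ := by linarith
  have br : r * (3 * P + |Q|) ≤ 80 := by
    rcases hr.eq_or_lt with h | h
    · rw [← h]; norm_num
    have h2 := integral_poisson_le_of_pos h ht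
    have h3 := abs_integral_conjPoisson_sin_le h ht
    calc r * (3 * P + |Q|) ≤ r * (3 * (Real.pi ^ 2 / (2 * r)) + (2 + 5 * Real.pi) / r) := by gcongr
      _ = 3 / 2 * Real.pi ^ 2 + 2 + 5 * Real.pi := by field_simp; ring
      _ ≤ _ := by nlinarith
  have hs : 0 < Real.sqrt (r ^ 2 + t ^ 2) := Real.sqrt_pos.2 (by positivity)
  have hs2 : Real.sqrt (r ^ 2 + t ^ 2) ≤ r + |t| := by
    rw [Real.sqrt_le_left (by positivity)]
    nlinarith [sq_abs t]
  have hX0 : 0 ≤ 3 * P + |Q| := (norm_nonneg _).trans hX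
  rw [le_div_iff₀ hs]
  calc _ ≤ (3 * P + |Q|) * (r + |t|) := by gcongr
    _ ≤ 100 := by linarith

lemma norm_faddeevG_le {w : ℂ × ℝ} (hw : w.2 ≠ 0) :
    ‖faddeevG w‖ ≤ 100 / Real.sqrt (‖w.1‖ ^ 2 + w.2 ^ 2) := by
  unfold faddeevG
  rw [norm_mul, Complex.norm_real, Real.norm_of_nonneg (by positivity)]
  refine (mul_le_of_le_one_left (norm_nonneg _) ?_).trans
    (norm_integral_faddeevDensity_le (norm_nonneg _) hw)
  rw [div_le_one (by positivity)]
  nlinarith [Real.pi_gt_three]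

/-! ### Decay of the rescaled fundamental solution -/

lemma measurable_faddeevG : Measurable faddeevG := by
  unfold faddeevG
  refine Measurable.const_mul ?_ _
  have hm : StronglyMeasurable (Function.uncurry fun (w : ℂ × ℝ) (φ : ℝ) =>
      faddeevDensity ‖w.1‖ w.2 (Real.sin φ)) := by
    refine Measurable.stronglyMeasurable ?_
    simp only [Function.uncurry_def]
    unfold faddeevDensity
    fun_prop
  simp_rw [intervalIntegral.integral_of_le (show -(Real.pi / 2) ≤ Real.pi / 2 by
    linarith [Real.pi_pos])]
  exact (hm.integral_prod_right (ν := volume.restrict _)).measurable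

/-- The Riemann-Lebesgue lemma after the substitution `s = sin φ`. No integrability of `g` is needed,
since the Riemann-Lebesgue lemma holds trivially for the junk value of the integral. -/
lemma tendsto_integral_exp_sin {g : ℝ → ℂ} {r : ℝ} (hr : 0 < r) :
    Tendsto (fun τ : ℝ => ∫ φ in (-(Real.pi / 2))..(Real.pi / 2),
      Complex.exp (τ * (r * Real.sin φ) * I) * g (Real.sin φ)) atTop (𝓝 0) := by
  set S : Set ℝ := Set.Ioo (-(Real.pi / 2)) (Real.pi / 2) with hS
  have hpi := Real.pi_pos
  have hinj : Set.InjOn Real.sin S := Real.injOn_sin.mono Set.Ioo_subset_Icc_self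
  have hSm : MeasurableSet (Real.sin '' S) :=
    measurableSet_Ioo.image_of_continuousOn_injOn Real.continuous_sin.continuousOn hinj
  set h : ℝ → ℂ := (Real.sin '' S).indicator
    fun s => ((Real.sqrt (1 - s ^ 2))⁻¹ : ℝ) • g s with hh
  have key : ∀ τ : ℝ, ∫ φ in (-(Real.pi / 2))..(Real.pi / 2),
      Complex.exp (τ * (r * Real.sin φ) * I) * g (Real.sin φ) =
      ∫ s : ℝ, 𝐞 (-(s * (-(τ * r / (2 * Real.pi))))) • h s := by
    intro τ
    have e1 : ∀ s : ℝ, 𝐞 (-(s * (-(τ * r / (2 * Real.pi))))) • h s =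
        (Real.sin '' S).indicator (fun s : ℝ => Complex.exp (τ * (r * s) * I) *
          (((Real.sqrt (1 - s ^ 2))⁻¹ : ℝ) • g s)) s := by
      intro s
      by_cases hs : s ∈ Real.sin '' S
      · rw [hh, Set.indicator_of_mem hs, Set.indicator_of_mem hs, Circle.smul_def,
          Real.fourierChar_apply, smul_eq_mul]
        congr 2
        push_cast
        have : (Real.pi : ℂ) ≠ 0 := by exact_mod_cast hpi.ne'
        field_simp
      · rw [hh, Set.indicator_of_notMem hs, Set.indicator_of_notMem hs, smul_zero]
    simp_rw [e1]
    rw [integral_indicator hSm, integral_image_eq_integral_abs_deriv_smul measurableSet_Ioo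
      (fun x _ => (Real.hasDerivAt_sin x).hasDerivWithinAt) hinj,
      intervalIntegral.integral_of_le (by linarith), integral_Ioc_eq_integral_Ioo]
    refine setIntegral_congr_fun measurableSet_Ioo fun φ hφ => ?_
    have hc : 0 < Real.cos φ := Real.cos_pos_of_mem_Ioo hφ
    have hsq : Real.sqrt (1 - Real.sin φ ^ 2) = Real.cos φ := by
      rw [← Real.cos_sq', Real.sqrt_sq hc.le]
    simp only [hsq, abs_of_pos hc, Complex.real_smul]
    have : (Real.cos φ : ℂ) ≠ 0 := by exact_mod_cast hc.ne'
    rw [Complex.ofReal_inv]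
    field_simp
  simp_rw [key]
  refine (Real.tendsto_integral_exp_smul_cocompact h).comp
    (Tendsto.mono_right ?_ atBot_le_cocompact)
  have : Tendsto (fun τ : ℝ => τ * (r / (2 * Real.pi))) atTop atTop :=
    tendsto_id.atTop_mul_const (by positivity)
  refine (tendsto_neg_atTop_atBot.comp this).congr fun τ => ?_
  simp only [Function.comp]; ring

lemma tendsto_faddeevG_smul {w : ℂ × ℝ} (h1 : w.1 ≠ 0) (h2 : w.2 ≠ 0) :
    Tendsto (fun τ : ℝ => (τ : ℂ) * faddeevG (τ • w)) atTop (𝓝 0) := by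
  set r := ‖w.1‖ with hr
  set t := w.2 with ht
  have hr0 : 0 < r := norm_pos_iff.2 h1
  set J : ℝ := ∫ φ in (-(Real.pi / 2))..(Real.pi / 2), (t ^ 2 + (r * Real.sin φ) ^ 2)⁻¹ with hJ
  have lim1 := tendsto_integral_exp_sin (g := fun c => (t - r * c * I : ℂ)⁻¹) hr0
  have lim2 : Tendsto (fun τ : ℝ => ((Real.exp (τ * t) * (|t| - t) * J : ℝ) : ℂ)) atTop (𝓝 0) := by
    rw [← Complex.ofReal_zero]
    refine (Complex.continuous_ofReal.tendsto 0).comp ?_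
    rcases lt_or_gt_of_ne h2 with h | h
    · have : Tendsto (fun τ : ℝ => Real.exp (τ * t)) atTop (𝓝 0) :=
        Real.tendsto_exp_atBot.comp (tendsto_id.atTop_mul_const_of_neg h)
      simpa using (this.mul_const (|t| - t)).mul_const J
    · simp [abs_of_pos h]
  have lim := ((lim1.add lim2).const_mul ((1 / (4 * Real.pi ^ 2) : ℝ) : ℂ))
  rw [add_zero, mul_zero] at lim
  refine lim.congr' ?_
  filter_upwards [eventually_gt_atTop 0] with τ hτ
  have hτ' : (τ : ℂ) ≠ 0 := by exact_mod_cast hτ.ne'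
  have e : ∀ c : ℝ, faddeevDensity ‖(τ • w).1‖ (τ • w).2 c = (τ : ℂ)⁻¹ *
      (Complex.exp (τ * (r * c) * I) * (t - r * c * I : ℂ)⁻¹ +
        ((Real.exp (τ * t) * (|t| - t) * (t ^ 2 + (r * c) ^ 2)⁻¹ : ℝ) : ℂ)) := by
    intro c
    have d1 := ofReal_sub_mul_I_ne_zero h2 (r * c)
    push_cast at d1
    have d2 : t ^ 2 + (r * c) ^ 2 ≠ 0 := by positivity
    have d3 : (t ^ 2 + (r * c) ^ 2 : ℂ) ≠ 0 := by exact_mod_cast d2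
    simp only [faddeevDensity, Prod.smul_fst, Prod.smul_snd, norm_smul, Real.norm_eq_abs,
      abs_of_pos hτ, smul_eq_mul, ← hr, ← ht, abs_mul]
    push_cast
    have e1 : (τ * t - τ * r * c * I : ℂ) = τ * (t - r * c * I) := by ring
    have e2 : ((τ * t) ^ 2 + (τ * r * c) ^ 2 : ℂ) = τ ^ 2 * (t ^ 2 + (r * c) ^ 2) := by ring
    rw [e1, e2, ← mul_assoc (τ : ℂ) r c]
    field_simp
  unfold faddeevG
  simp_rw [e]
  have c1 : Continuous fun φ : ℝ => Complex.exp (τ * (r * Real.sin φ) * I) *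
      (t - r * Real.sin φ * I : ℂ)⁻¹ := by
    refine Continuous.mul (by fun_prop) (Continuous.inv₀ (by fun_prop) fun φ => ?_)
    have d1 := ofReal_sub_mul_I_ne_zero h2 (r * Real.sin φ)
    push_cast at d1
    exact_mod_cast d1
  have c2 : Continuous fun φ : ℝ => ((Real.exp (τ * t) * (|t| - t) *
      (t ^ 2 + (r * Real.sin φ) ^ 2)⁻¹ : ℝ) : ℂ) :=
    Complex.continuous_ofReal.comp (continuous_const.mul
      (Continuous.inv₀ (by fun_prop) fun φ => by positivity))
  rw [intervalIntegral.integral_const_mul, intervalIntegral.integral_add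
    (c1.intervalIntegrable _ _) (c2.intervalIntegrable _ _), intervalIntegral.integral_ofReal,
    intervalIntegral.integral_const_mul, ← hJ, mul_left_comm (τ : ℂ), mul_inv_cancel_left₀ hτ']

/-- The Euclidean norm on `ℂ × ℝ`, whose own norm is the maximum norm. -/
noncomputable def cylNorm (w : ℂ × ℝ) : ℝ := Real.sqrt (‖w.1‖ ^ 2 + w.2 ^ 2)

lemma measurable_cylNorm : Measurable cylNorm := by unfold cylNorm; fun_prop

lemma norm_fst_le_cylNorm (w : ℂ × ℝ) : ‖w.1‖ ≤ cylNorm w :=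
  Real.le_sqrt_of_sq_le (by nlinarith [sq_nonneg w.2])

lemma abs_snd_le_cylNorm (w : ℂ × ℝ) : |w.2| ≤ cylNorm w :=
  Real.abs_le_sqrt (by nlinarith [sq_nonneg ‖w.1‖])

/-- An integrable weight with the singularities `|u|^{-1/2}` and `|t|^{-1/2}` of the majorant of
`faddeevG`, corrected by powers of `1 + |u|` and `1 + |t|` to be integrable at infinity. -/
noncomputable def cylWeight (w : ℂ × ℝ) : ℝ :=
  (‖w.1‖ ^ (-(1/2) : ℝ) * (1 + ‖w.1‖) ^ (-2 : ℝ)) * (|w.2| ^ (-(1/2) : ℝ) * (1 + |w.2|) ^ (-1 : ℝ))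

lemma integrable_cylWeight : Integrable cylWeight := by
  refine Integrable.mul_prod (f := fun u : ℂ => ‖u‖ ^ (-(1/2) : ℝ) * (1 + ‖u‖) ^ (-2 : ℝ))
    (g := fun t : ℝ => |t| ^ (-(1/2) : ℝ) * (1 + |t|) ^ (-1 : ℝ)) ?_ ?_
  · exact integrable_norm_rpow_mul (E := ℂ) volume (by simp; norm_num) (by simp; norm_num)
      (by norm_num)
  · exact integrable_norm_rpow_mul (E := ℝ) volume (by simp; norm_num) (by simp; norm_num)
      (by norm_num)

lemma one_div_cylNorm_le {w : ℂ × ℝ} (h1 : w.1 ≠ 0) (h2 : w.2 ≠ 0) :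
    1 / cylNorm w ≤ ‖w.1‖ ^ (-(1/2) : ℝ) * |w.2| ^ (-(1/2) : ℝ) := by
  simpa [cylNorm] using inv_sqrt_le (norm_ne_zero_iff.2 h1) h2

lemma rpow_mul_rpow_le_cylWeight (w : ℂ × ℝ) :
    ‖w.1‖ ^ (-(1/2) : ℝ) * |w.2| ^ (-(1/2) : ℝ) ≤ (1 + cylNorm w) ^ 3 * cylWeight w := by
  have h1 := norm_fst_le_cylNorm w
  have h2 := abs_snd_le_cylNorm w
  have h3 := norm_nonneg w.1
  have h4 := abs_nonneg w.2
  have e : cylWeight w = (‖w.1‖ ^ (-(1/2) : ℝ) * |w.2| ^ (-(1/2) : ℝ)) *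
      ((1 + ‖w.1‖) ^ 2 * (1 + |w.2|))⁻¹ := by
    unfold cylWeight
    rw [Real.rpow_neg_one, Real.rpow_neg (by positivity) 2, Real.rpow_two, mul_inv]
    ring
  rw [e, mul_left_comm]
  refine le_mul_of_one_le_right (by positivity) ?_
  rw [← div_eq_mul_inv, one_le_div (by positivity)]
  calc _ ≤ (1 + cylNorm w) ^ 2 * (1 + cylNorm w) := by gcongr
    _ = _ := by ring

/-- The rescaled fundamental solutions tend to zero in `L¹` of every ball. -/
lemma tendsto_lintegral_faddeevG (L : ℝ) :
    Tendsto (fun τ : ℝ => ∫⁻ w in {w | cylNorm w < L}, ‖(τ : ℂ) * faddeevG (τ • w)‖ₑ)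
      atTop (𝓝 0) := by
  have hS : MeasurableSet {w | cylNorm w < L} := measurableSet_lt measurable_cylNorm measurable_const
  have hae : ∀ᵐ w ∂(volume.restrict {w | cylNorm w < L}),
      (w.1 ≠ 0 ∧ w.2 ≠ 0) ∧ cylNorm w < L :=
    (ae_restrict_of_ae (ae_prod_of_ae ae_ne_zero_complex ae_ne_zero_real)).and
      (ae_restrict_mem hS)
  rw [← lintegral_zero (α := ℂ × ℝ) (μ := volume.restrict {w | cylNorm w < L})]
  refine tendsto_lintegral_filter_of_dominated_convergence
    (fun w => ENNReal.ofReal (100 * (1 + |L|) ^ 3 * cylWeight w)) ?_ ?_ ?_ ?_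
  · refine Eventually.of_forall fun τ => ?_
    have := measurable_faddeevG
    fun_prop
  · filter_upwards [eventually_gt_atTop 0] with τ hτ
    filter_upwards [hae] with w hw
    rw [← ofReal_norm]
    apply ENNReal.ofReal_le_ofReal
    have hb := norm_faddeevG_le (w := τ • w) (by simp [hτ.ne', hw.1.2])
    have hN : Real.sqrt (‖(τ • w).1‖ ^ 2 + (τ • w).2 ^ 2) = τ * cylNorm w := by
      simp only [Prod.smul_fst, Prod.smul_snd, norm_smul, Real.norm_eq_abs, abs_of_pos hτ,
        smul_eq_mul, cylNorm]
      rw [mul_pow, mul_pow, ← mul_add, Real.sqrt_mul (by positivity), Real.sqrt_sq hτ.le]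
    rw [hN] at hb
    have hN0 : 0 ≤ cylNorm w := Real.sqrt_nonneg _
    have hW : 0 ≤ cylWeight w := by unfold cylWeight; positivity
    rw [norm_mul, Complex.norm_real, Real.norm_of_nonneg hτ.le]
    calc τ * ‖faddeevG (τ • w)‖ ≤ τ * (100 / (τ * cylNorm w)) := by gcongr
      _ = 100 * (1 / cylNorm w) := by
        rcases hN0.eq_or_lt with h | h
        · rw [← h]; simp
        · field_simp
      _ ≤ 100 * ((1 + cylNorm w) ^ 3 * cylWeight w) := by
        gcongr
        exact (one_div_cylNorm_le hw.1.1 hw.1.2).trans (rpow_mul_rpow_le_cylWeight w)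
      _ ≤ 100 * ((1 + |L|) ^ 3 * cylWeight w) := by
        gcongr
        exact hw.2.le.trans (le_abs_self L)
      _ = _ := by ring
  · exact ((integrable_cylWeight.const_mul _).integrableOn).lintegral_lt_top.ne
  · filter_upwards [hae] with w hw
    have := (tendsto_faddeevG_smul hw.1.1 hw.1.2).enorm
    simpa using this

/-! ### Frames adapted to a complex null vector -/

/-- The map `e` identifies `ℂ × ℝ` with `ℝ³` by an orthonormal basis in which `ω` spans the image of
the factor `ℝ`. Only the properties needed for changes of variables are recorded. -/
structure IsFrame (ω : R3) (e : (ℂ × ℝ) ≃ᵐ R3) : Prop where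
  measurePreserving : MeasurePreserving e volume volume
  inner_map : ∀ q w, inner ℝ (e q) (e w) = cylDot q w
  inner_axis : ∀ w, inner ℝ ω (e w) = w.2
  map_smul : ∀ (c : ℝ) w, e (c • w) = c • e w

lemma exists_isFrame {ω : R3} (hω : ‖ω‖ = 1) : ∃ e : (ℂ × ℝ) ≃ᵐ R3, IsFrame ω e := by
  obtain ⟨B, hB⟩ := Orthonormal.exists_orthonormalBasis_extension_of_card_eq (𝕜 := ℝ) (E := R3)
    (ι := Fin 3) (by simp) (v := fun _ => ω) (s := {0}) (by
      refine ⟨fun i => hω, fun i j hij => absurd (Subtype.ext ?_) hij⟩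
      rw [Set.mem_singleton_iff.1 i.2, Set.mem_singleton_iff.1 j.2])
  have hB0 : B 0 = ω := hB 0 rfl
  let e1 : (ℂ × ℝ) ≃ᵐ ℝ × (Fin 2 → ℝ) :=
    MeasurableEquiv.prodComm.trans
      (MeasurableEquiv.prodCongr (MeasurableEquiv.refl ℝ) Complex.measurableEquivPi)
  let e2 : (Fin 3 → ℝ) ≃ᵐ ℝ × (Fin 2 → ℝ) := MeasurableEquiv.piFinSuccAbove (fun _ => ℝ) 0
  let e3 : (Fin 3 → ℝ) ≃ᵐ EuclideanSpace ℝ (Fin 3) := MeasurableEquiv.toLp 2 _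
  let e4 : EuclideanSpace ℝ (Fin 3) ≃ᵐ R3 := B.repr.symm.toHomeomorph.toMeasurableEquiv
  let e : (ℂ × ℝ) ≃ᵐ R3 := (e1.trans e2.symm).trans (e3.trans e4)
  have he : ∀ w, e w = B.repr.symm (WithLp.toLp 2 ![w.2, w.1.re, w.1.im]) := by
    intro w
    change B.repr.symm (WithLp.toLp 2 (Fin.insertNth 0 w.2 ![w.1.re, w.1.im])) = _
    congr 2
    ext i
    fin_cases i <;> rfl
  refine ⟨e, ?_, ?_, ?_, ?_⟩
  · have m1 : MeasurePreserving e1 volume volume :=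
      ((MeasurePreserving.id volume).prod Complex.volume_preserving_equiv_pi).comp
        Measure.measurePreserving_swap
    have m2 : MeasurePreserving e2.symm volume volume :=
      (volume_preserving_piFinSuccAbove (fun _ : Fin 3 => ℝ) 0).symm
    have m3 : MeasurePreserving e3 volume volume := PiLp.volume_preserving_toLp (Fin 3)
    have m4 : MeasurePreserving e4 volume volume := B.measurePreserving_repr_symm
    exact (m4.comp m3).comp (m2.comp m1)
  · intro q w
    rw [he, he, LinearIsometryEquiv.inner_map_map]
    simp [PiLp.inner_apply, Fin.sum_univ_three, cylDot]
    ring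
  · intro w
    rw [he, ← hB0, ← B.repr_apply_apply]
    simp
  · intro c w
    rw [he, he, ← LinearIsometryEquiv.map_smul]
    congr 1
    ext i
    fin_cases i <;> simp

namespace IsFrame
variable {ω : R3} {e : (ℂ × ℝ) ≃ᵐ R3}

lemma norm_map (he : IsFrame ω e) (w : ℂ × ℝ) : ‖e w‖ = cylNorm w := by
  rw [norm_eq_sqrt_real_inner, he.inner_map, cylNorm]
  congr 1
  rw [cylDot, Complex.mul_conj, Complex.ofReal_re, Complex.normSq_eq_norm_sq]
  ring

end IsFrame

/-- The vector of the real parts of the coordinates. -/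
noncomputable def rePart (z : C3) : R3 := WithLp.toLp 2 fun j => (z j).re

/-- The vector of the imaginary parts of the coordinates. -/
noncomputable def imPart (z : C3) : R3 := WithLp.toLp 2 fun j => (z j).im

lemma norm_rePart_of_bilinSq {z : C3} (hz : bilinSq z = 0) : ‖rePart z‖ = ‖z‖ / Real.sqrt 2 := by
  have h : ‖rePart z‖ ^ 2 = ‖z‖ ^ 2 / 2 := by
    have h0 := congrArg Complex.re hz
    simp only [bilinSq, Fin.sum_univ_three, Complex.add_re, Complex.mul_re,
      Complex.zero_re] at h0
    rw [EuclideanSpace.norm_sq_eq, EuclideanSpace.norm_sq_eq]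
    simp only [Fin.sum_univ_three, rePart, Real.norm_eq_abs, sq_abs, ← Complex.normSq_eq_norm_sq,
      Complex.normSq_apply]
    linarith
  rw [← Real.sqrt_sq (norm_nonneg (rePart z)), h, Real.sqrt_div (sq_nonneg _),
    Real.sqrt_sq (norm_nonneg z)]

lemma norm_imPart_of_bilinSq {z : C3} (hz : bilinSq z = 0) : ‖imPart z‖ = ‖z‖ / Real.sqrt 2 := by
  have h : ‖imPart z‖ ^ 2 = ‖z‖ ^ 2 / 2 := by
    have h0 := congrArg Complex.re hz
    simp only [bilinSq, Fin.sum_univ_three, Complex.add_re, Complex.mul_re,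
      Complex.zero_re] at h0
    rw [EuclideanSpace.norm_sq_eq, EuclideanSpace.norm_sq_eq]
    simp only [Fin.sum_univ_three, imPart, Real.norm_eq_abs, sq_abs, ← Complex.normSq_eq_norm_sq,
      Complex.normSq_apply]
    linarith
  rw [← Real.sqrt_sq (norm_nonneg (imPart z)), h, Real.sqrt_div (sq_nonneg _),
    Real.sqrt_sq (norm_nonneg z)]

lemma inner_rePart_imPart {z : C3} (hz : bilinSq z = 0) : inner ℝ (imPart z) (rePart z) = 0 := by
  have h0 := congrArg Complex.im hz
  simp only [bilinSq, Fin.sum_univ_three, Complex.add_im, Complex.mul_im, Complex.zero_im] at h0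
  simp [PiLp.inner_apply, Fin.sum_univ_three, rePart, imPart]
  linarith

lemma conjSymbol_eq (z : C3) (ξ : R3) :
    conjSymbol z ξ = ((‖ξ‖ ^ 2 + 2 * inner ℝ (rePart z) ξ : ℝ) : ℂ) +
      ((2 * inner ℝ (imPart z) ξ : ℝ) : ℂ) * I := by
  apply Complex.ext
  · simp [conjSymbol, Fin.sum_univ_three, PiLp.inner_apply, rePart, imPart]
    ring
  · simp [conjSymbol, Fin.sum_univ_three, PiLp.inner_apply, rePart, imPart]
    ring

lemma conjSymbol_frame {z : C3} (hz : bilinSq z = 0) {τ : ℝ} (hτ : 0 < τ) (ha : ‖rePart z‖ = τ)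
    {e : (ℂ × ℝ) ≃ᵐ R3} (he : IsFrame (τ⁻¹ • imPart z) e) (q : ℂ × ℝ) :
    conjSymbol z (τ • e q - rePart z) = τ ^ 2 * modelSymbol q := by
  have h1 : inner ℝ (imPart z) (e q) = τ * q.2 := by
    have := he.inner_axis q
    rw [real_inner_smul_left] at this
    rw [← this]; field_simp
  have h2 : ‖τ • e q - rePart z‖ ^ 2 + 2 * inner ℝ (rePart z) (τ • e q - rePart z) =
      τ ^ 2 * (‖q.1‖ ^ 2 + q.2 ^ 2) - τ ^ 2 := by
    rw [norm_sub_sq_real, inner_sub_right, real_inner_self_eq_norm_sq, norm_smul, ha,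
      he.norm_map, cylNorm, mul_pow, Real.sq_sqrt (by positivity), Real.norm_of_nonneg hτ.le,
      real_inner_comm]
    ring
  have h3 : inner ℝ (imPart z) (τ • e q - rePart z) = τ ^ 2 * q.2 := by
    rw [inner_sub_right, inner_rePart_imPart hz, inner_smul_right, h1]; ring
  rw [conjSymbol_eq, h2, h3, modelSymbol]
  push_cast
  linear_combination (-(τ:ℂ) ^ 2) * Complex.I_sq

lemma SchwartzMap.exists_one_add_norm_pow_mul_le (φ : 𝓢(R3, ℂ)) (k : ℕ) :
    ∃ C : ℝ, ∀ x, (1 + ‖x‖) ^ k * ‖φ x‖ ≤ C := by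
  refine ⟨2 ^ k * ((Finset.Iic (k, 0)).sup fun m => SchwartzMap.seminorm ℝ m.1 m.2) φ,
    fun x => ?_⟩
  have := SchwartzMap.one_add_le_sup_seminorm_apply (𝕜 := ℝ) (m := (k, 0)) le_rfl le_rfl φ x
  rwa [norm_iteratedFDeriv_zero] at this

/-! ### The fundamental solution for a complex null vector -/

/-- The function `e^{-i a · x} τ F(τ x)`, with `F` read in the frame `e`. -/
noncomputable def conjFundSol (a : R3) (τ : ℝ) (e : (ℂ × ℝ) ≃ᵐ R3) (x : R3) : ℂ :=
  Complex.exp (-(inner ℝ a x : ℝ) * I) * (τ * faddeevG (τ • e.symm x))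

lemma measurable_conjFundSol (a : R3) (τ : ℝ) (e : (ℂ × ℝ) ≃ᵐ R3) :
    Measurable (conjFundSol a τ e) := by
  unfold conjFundSol
  have h1 := measurable_faddeevG
  have h2 := e.symm.measurable
  have h3 : Measurable fun x : R3 => inner ℝ a x := by fun_prop
  fun_prop

lemma norm_conjFundSol (a : R3) (τ : ℝ) (e : (ℂ × ℝ) ≃ᵐ R3) (x : R3) :
    ‖conjFundSol a τ e x‖ = ‖(τ : ℂ) * faddeevG (τ • e.symm x)‖ := by
  rw [conjFundSol, norm_mul, ← Complex.ofReal_neg, Complex.norm_exp_ofReal_mul_I, one_mul]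

lemma cylNorm_smul {τ : ℝ} (hτ : 0 < τ) (w : ℂ × ℝ) : cylNorm (τ • w) = τ * cylNorm w := by
  simp only [Prod.smul_fst, Prod.smul_snd, norm_smul, Real.norm_eq_abs, abs_of_pos hτ,
    smul_eq_mul, cylNorm]
  rw [mul_pow, mul_pow, ← mul_add, Real.sqrt_mul (by positivity), Real.sqrt_sq hτ.le]

lemma norm_conjFundSol_le {ω : R3} {e : (ℂ × ℝ) ≃ᵐ R3} (he : IsFrame ω e) (a : R3) {τ : ℝ}
    (hτ : 0 < τ) : ∀ᵐ x : R3, ‖conjFundSol a τ e x‖ ≤ 100 / ‖x‖ := by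
  have h : ∀ᵐ w : ℂ × ℝ, w.2 ≠ 0 := (ae_prod_of_ae ae_ne_zero_complex ae_ne_zero_real).mono
    fun w hw => hw.2
  have h' : ∀ᵐ x : R3, (e.symm x).2 ≠ 0 :=
    (he.measurePreserving.symm e).quasiMeasurePreserving.ae h
  filter_upwards [h'] with x hx
  have hb := norm_faddeevG_le (w := τ • e.symm x) (by simp [hτ.ne', hx])
  change _ ≤ 100 / cylNorm _ at hb
  rw [cylNorm_smul hτ, ← he.norm_map, e.apply_symm_apply] at hb
  rw [norm_conjFundSol, norm_mul, Complex.norm_real, Real.norm_of_nonneg hτ.le]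
  calc _ ≤ τ * (100 / (τ * ‖x‖)) := by gcongr
    _ = _ := by
      rcases (norm_nonneg x).eq_or_lt with h | h
      · rw [← h]; simp
      · field_simp

lemma finrank_R3 : Module.finrank ℝ R3 = 3 := by simp

lemma integrable_norm_inv_mul : Integrable fun x : R3 => ‖x‖ ^ (-1 : ℝ) * (1 + ‖x‖) ^ (-3 : ℝ) :=
  integrable_norm_rpow_mul (E := R3) volume (by simp) (by simp; norm_num) (by norm_num)

lemma integrable_mul_of_norm_le_inv {E φ : R3 → ℂ} (hE : AEStronglyMeasurable E)
    (hφ : AEStronglyMeasurable φ) {A C : ℝ} (hA : ∀ᵐ x : R3, ‖E x‖ ≤ A / ‖x‖)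
    (hC : ∀ x, (1 + ‖x‖) ^ 3 * ‖φ x‖ ≤ C) : Integrable fun x => E x * φ x := by
  refine (integrable_norm_inv_mul.const_mul (|A| * C)).mono' (hE.mul hφ) ?_
  filter_upwards [hA] with x hx
  have hp : 0 < 1 + ‖x‖ := by positivity
  have h2 : ‖φ x‖ ≤ C * (1 + ‖x‖) ^ (-3 : ℝ) := by
    rw [Real.rpow_neg hp.le, ← div_eq_mul_inv, le_div_iff₀ (by positivity)]
    have := hC x
    norm_cast
    linarith
  have h3 : ‖E x‖ ≤ |A| * ‖x‖ ^ (-1 : ℝ) := by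
    rw [Real.rpow_neg_one, ← div_eq_mul_inv]
    exact hx.trans (by gcongr; exact le_abs_self A)
  rw [norm_mul]
  calc _ ≤ (|A| * ‖x‖ ^ (-1 : ℝ)) * (C * (1 + ‖x‖) ^ (-3 : ℝ)) := by gcongr
    _ = _ := by ring

lemma locallyIntegrable_of_norm_le_inv {E : R3 → ℂ} (hE : AEStronglyMeasurable E)
    {A : ℝ} (hA : ∀ᵐ x : R3, ‖E x‖ ≤ A / ‖x‖) : LocallyIntegrable E := by
  have hp : ∀ x : R3, (((1 + ‖x‖) ^ 3 : ℝ) : ℂ) ≠ 0 := fun x => by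
    have : (1 + ‖x‖) ^ 3 ≠ 0 := by positivity
    exact_mod_cast this
  have hc : Continuous fun x : R3 => ((((1 + ‖x‖) ^ 3 : ℝ) : ℂ))⁻¹ :=
    Continuous.inv₀ (by fun_prop) hp
  have h := (integrable_mul_of_norm_le_inv hE (φ := fun x => ((((1 + ‖x‖) ^ 3 : ℝ) : ℂ))⁻¹)
    hc.aestronglyMeasurable hA (C := 1) fun x => ?_).locallyIntegrable
  · have h2 := LocallyIntegrableOn.continuousOn_mul (s := Set.univ)
      (g := fun x : R3 => (((1 + ‖x‖) ^ 3 : ℝ) : ℂ))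
      (locallyIntegrableOn_univ.2 h) (by fun_prop : Continuous _).continuousOn
      isOpen_univ.isLocallyClosed
    rw [locallyIntegrableOn_univ] at h2
    refine h2.congr (Eventually.of_forall fun x => ?_)
    simp only
    rw [mul_comm, mul_assoc, inv_mul_cancel₀ (hp x), mul_one]
  · rw [norm_inv, Complex.norm_real, Real.norm_of_nonneg (by positivity)]
    exact (mul_inv_cancel₀ (by positivity)).le

section Pairing

variable {z : C3} {τ : ℝ} {e : (ℂ × ℝ) ≃ᵐ R3}

/-- The function `e^{-i a · x} φ(x)` at `x = τ⁻¹ e w`: the test function that corresponds to `φ` in the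
model. -/
noncomputable def pullback (a : R3) (τ : ℝ) (e : (ℂ × ℝ) ≃ᵐ R3) (φ : R3 → ℂ) (w : ℂ × ℝ) : ℂ :=
  Complex.exp (-(inner ℝ a (τ⁻¹ • e w) : ℝ) * I) * φ (τ⁻¹ • e w)

lemma norm_pullback (a : R3) (τ : ℝ) (e : (ℂ × ℝ) ≃ᵐ R3) (φ : R3 → ℂ) (w : ℂ × ℝ) :
    ‖pullback a τ e φ w‖ = ‖φ (τ⁻¹ • e w)‖ := by
  rw [pullback, norm_mul, ← Complex.ofReal_neg, Complex.norm_exp_ofReal_mul_I, one_mul]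

lemma finrank_complex_prod_real : Module.finrank ℝ (ℂ × ℝ) = 3 := by simp

/-- The Fourier transform of the pulled back test function. The dilation, the modulation by `a` and
the change to the variable `ξ = 2π η` become an affine substitution. -/
lemma integral_exp_mul_pullback {ω : R3} (he : IsFrame ω e) (a : R3) (hτ : 0 < τ) (φ : 𝓢(R3, ℂ))
    (q : ℂ × ℝ) :
    ∫ w, Complex.exp (cylDot q w * I) * pullback a τ e φ w =
      τ ^ 3 * (𝓕⁻ φ) ((τ / (2 * Real.pi)) • e q - (2 * Real.pi)⁻¹ • a) := by
  have hpi := Real.pi_pos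
  set g : R3 → ℂ := fun x => Complex.exp ((inner ℝ (τ • e q - a) x : ℝ) * I) * φ x with hg
  have e1 : ∀ w, Complex.exp (cylDot q w * I) * pullback a τ e φ w = g (τ⁻¹ • e w) := by
    intro w
    simp only [hg, pullback]
    rw [← mul_assoc, ← Complex.exp_add, ← he.inner_map]
    congr 2
    have : inner ℝ (τ • e q - a) (τ⁻¹ • e w) = inner ℝ (e q) (e w) - inner ℝ a (τ⁻¹ • e w) := by
      rw [inner_sub_left, real_inner_smul_left, real_inner_smul_right]; field_simp
    rw [this]
    push_cast; ring
  simp_rw [e1]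
  rw [he.measurePreserving.integral_comp' (fun x => g (τ⁻¹ • x)), Measure.integral_comp_smul,
    finrank_R3, SchwartzMap.fourierInv_coe, Real.fourierInv_eq', inv_pow, inv_inv,
    abs_of_pos (by positivity), Complex.real_smul]
  push_cast
  congr 1
  refine integral_congr_ae (Eventually.of_forall fun x => ?_)
  simp only [hg, smul_eq_mul]
  congr 3
  rw [real_inner_comm x, inner_sub_right, inner_sub_right, real_inner_smul_right,
    real_inner_smul_right, real_inner_smul_right]
  have : (Real.pi : ℂ) ≠ 0 := by exact_mod_cast hpi.ne'
  push_cast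
  field_simp

lemma one_add_norm_le_frame {ω : R3} (he : IsFrame ω e) (a : R3) (hτ : 0 < τ) (q : ℂ × ℝ) :
    1 + ‖q.1‖ ≤ (1 + (2 * Real.pi + ‖a‖) / τ) *
      (1 + ‖(τ / (2 * Real.pi)) • e q - (2 * Real.pi)⁻¹ • a‖) := by
  have hpi := Real.pi_pos
  set η := (τ / (2 * Real.pi)) • e q - (2 * Real.pi)⁻¹ • a with hη
  have h1 : τ • e q = (2 * Real.pi) • η + a := by
    rw [hη, smul_sub, smul_smul, smul_smul, mul_inv_cancel₀ (by positivity), one_smul,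
      sub_add_cancel]
    congr 1; field_simp
  have h2 : τ * ‖e q‖ ≤ 2 * Real.pi * ‖η‖ + ‖a‖ := by
    rw [← Real.norm_of_nonneg hτ.le, ← norm_smul, h1]
    refine (norm_add_le _ _).trans ?_
    rw [norm_smul, Real.norm_of_nonneg (by positivity)]
  have h3 : ‖q.1‖ ≤ ‖e q‖ := he.norm_map q ▸ norm_fst_le_cylNorm q
  have h4 : ‖q.1‖ ≤ (2 * Real.pi * ‖η‖ + ‖a‖) / τ := by
    rw [le_div_iff₀ hτ]
    nlinarith
  have h5 : (2 * Real.pi * ‖η‖ + ‖a‖) / τ ≤ (2 * Real.pi + ‖a‖) / τ * (1 + ‖η‖) := by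
    rw [div_mul_eq_mul_div]
    gcongr
    nlinarith [norm_nonneg η, norm_nonneg a]
  nlinarith [norm_nonneg η]

lemma integrable_modelSymbol_inv_mul_fourier {ω : R3} (he : IsFrame ω e) (a : R3) (hτ : 0 < τ)
    (φ : 𝓢(R3, ℂ)) :
    Integrable fun q => (modelSymbol q)⁻¹ *
      φ ((τ / (2 * Real.pi)) • e q - (2 * Real.pi)⁻¹ • a) := by
  obtain ⟨C, hC⟩ := φ.exists_one_add_norm_pow_mul_le 2
  set K := 1 + (2 * Real.pi + ‖a‖) / τ with hK
  have hK0 : 0 < K := by have := Real.pi_pos; positivity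
  refine integrable_modelSymbol_inv_mul (C := K ^ 2 * C) ?_ fun q => ?_
  · have h1 := φ.continuous.measurable
    have h2 := e.measurable
    exact (h1.comp (by fun_prop : Measurable fun q =>
      (τ / (2 * Real.pi)) • e q - (2 * Real.pi)⁻¹ • a)).aestronglyMeasurable
  · have h1 := one_add_norm_le_frame he a hτ q
    rw [← hK] at h1
    have h2 := hC ((τ / (2 * Real.pi)) • e q - (2 * Real.pi)⁻¹ • a)
    generalize (τ / (2 * Real.pi)) • e q - (2 * Real.pi)⁻¹ • a = η at *
    have hp : 0 < 1 + ‖q.1‖ := by positivity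
    rw [Real.rpow_neg hp.le, ← div_eq_mul_inv, le_div_iff₀ (by positivity), Real.rpow_two]
    calc ‖φ η‖ * (1 + ‖q.1‖) ^ 2 ≤ ‖φ η‖ * (K * (1 + ‖η‖)) ^ 2 := by gcongr
      _ = K ^ 2 * ((1 + ‖η‖) ^ 2 * ‖φ η‖) := by ring
      _ ≤ _ := by gcongr

lemma integrable_pullback {ω : R3} (he : IsFrame ω e) (a : R3) (hτ : 0 < τ) (φ : 𝓢(R3, ℂ)) :
    Integrable (pullback a τ e φ) := by
  have h1 : Integrable fun x : R3 => φ (τ⁻¹ • x) := φ.integrable.comp_smul (inv_ne_zero hτ.ne')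
  have h2 := (he.measurePreserving.integrable_comp_emb e.measurableEmbedding).2 h1
  refine h2.bdd_mul (c := 1) ?_ (Eventually.of_forall fun w => ?_)
  · have h2 := e.measurable
    have h3 : Measurable fun x : R3 => inner ℝ a x := by fun_prop
    exact (by fun_prop : Measurable _).aestronglyMeasurable
  · rw [← Complex.ofReal_neg, Complex.norm_exp_ofReal_mul_I]

lemma integrable_rpow_mul_pullback {ω : R3} (he : IsFrame ω e) (a : R3) (hτ : 0 < τ)
    (φ : 𝓢(R3, ℂ)) :
    Integrable fun w : ℂ × ℝ =>
      ‖w.1‖ ^ (-(1/2) : ℝ) * |w.2| ^ (-(1/2) : ℝ) * ‖pullback a τ e φ w‖ := by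
  obtain ⟨C, hC⟩ := φ.exists_one_add_norm_pow_mul_le 3
  refine (integrable_cylWeight.const_mul ((1 + τ) ^ 3 * C)).mono' ?_
    (Eventually.of_forall fun w => ?_)
  · exact (by fun_prop : Measurable fun w : ℂ × ℝ =>
      ‖w.1‖ ^ (-(1/2) : ℝ) * |w.2| ^ (-(1/2) : ℝ)).aestronglyMeasurable.mul
      (integrable_pullback he a hτ φ).1.norm
  · have hW : 0 ≤ cylWeight w := by unfold cylWeight; positivity
    have hx := hC (τ⁻¹ • e w)
    have hN : cylNorm w = τ * ‖τ⁻¹ • e w‖ := by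
      rw [norm_smul, Real.norm_of_nonneg (inv_nonneg.2 hτ.le), he.norm_map]; field_simp
    have h1 := rpow_mul_rpow_le_cylWeight w
    rw [hN] at h1
    rw [Real.norm_of_nonneg (by positivity), norm_pullback]
    generalize τ⁻¹ • e w = x at *
    calc _ ≤ ((1 + τ * ‖x‖) ^ 3 * cylWeight w) * ‖φ x‖ := by gcongr
      _ ≤ (((1 + τ) * (1 + ‖x‖)) ^ 3 * cylWeight w) * ‖φ x‖ := by
        gcongr
        nlinarith [norm_nonneg x]
      _ = (1 + τ) ^ 3 * ((1 + ‖x‖) ^ 3 * ‖φ x‖) * cylWeight w := by ring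
      _ ≤ _ := by gcongr

theorem isFundSol_conjFundSol (hz : bilinSq z = 0) (hτ : 0 < τ) (ha : ‖rePart z‖ = τ)
    (he : IsFrame (τ⁻¹ • imPart z) e) : IsFundSol z (conjFundSol (rePart z) τ e) := by
  have hpi := Real.pi_pos
  set a := rePart z with ha'
  set c : ℝ := τ / (2 * Real.pi) with hc
  have hc0 : 0 < c := by positivity
  have hm := (measurable_conjFundSol a τ e).aestronglyMeasurable (μ := volume)
  have hb := norm_conjFundSol_le he a hτ
  have hsymb : ∀ q, conjSymbol z ((2 * Real.pi) • (c • e q - (2 * Real.pi)⁻¹ • a)) =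
      τ ^ 2 * modelSymbol q := by
    intro q
    rw [← conjSymbol_frame hz hτ ha he q, smul_sub, smul_smul, smul_smul,
      mul_inv_cancel₀ (by positivity), one_smul, hc]
    congr 3; field_simp
  have hG : ∀ (φ : 𝓢(R3, ℂ)) q, (fun η : R3 => (conjSymbol z ((2 * Real.pi) • η))⁻¹ * (𝓕⁻ φ) η)
      (c • e q - (2 * Real.pi)⁻¹ • a) =
      ((τ : ℂ) ^ 2)⁻¹ * ((modelSymbol q)⁻¹ * (𝓕⁻ φ) (c • e q - (2 * Real.pi)⁻¹ • a)) := by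
    intro φ q
    beta_reduce
    rw [hsymb q, mul_inv, mul_assoc]
  refine ⟨locallyIntegrable_of_norm_le_inv hm hb, fun φ => ?_, fun φ => ?_, fun φ => ?_⟩
  · obtain ⟨C, hC⟩ := φ.exists_one_add_norm_pow_mul_le 3
    exact integrable_mul_of_norm_le_inv hm φ.continuous.aestronglyMeasurable hb hC
  · set G : R3 → ℂ := fun η => (conjSymbol z ((2 * Real.pi) • η))⁻¹ * (𝓕⁻ φ) η with hGdef
    have h1 : Integrable fun q => G (c • e q - (2 * Real.pi)⁻¹ • a) := by
      simp_rw [hGdef, hG φ]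
      exact (integrable_modelSymbol_inv_mul_fourier he a hτ (𝓕⁻ φ)).const_mul _
    have h2 : Integrable fun x : R3 => G (c • x - (2 * Real.pi)⁻¹ • a) :=
      (he.measurePreserving.integrable_comp_emb e.measurableEmbedding).1 h1
    have h3 : Integrable fun x : R3 => G (x - (2 * Real.pi)⁻¹ • a) :=
      (integrable_comp_smul_iff volume (fun x => G (x - (2 * Real.pi)⁻¹ • a)) hc0.ne').1 h2
    simpa using h3.comp_add_right ((2 * Real.pi)⁻¹ • a)
  · set G : R3 → ℂ := fun η => (conjSymbol z ((2 * Real.pi) • η))⁻¹ * (𝓕⁻ φ) η with hGdef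
    have hint : Integrable fun q => (modelSymbol q)⁻¹ *
        ∫ w, Complex.exp (cylDot q w * I) * pullback a τ e φ w := by
      simp_rw [integral_exp_mul_pullback he a hτ φ, mul_left_comm _ ((τ : ℂ) ^ 3)]
      exact (integrable_modelSymbol_inv_mul_fourier he a hτ (𝓕⁻ φ)).const_mul _
    have key := integral_faddeevG_mul (integrable_pullback he a hτ φ)
      (integrable_rpow_mul_pullback he a hτ φ) hint
    simp_rw [integral_exp_mul_pullback he a hτ φ, mul_left_comm _ ((τ : ℂ) ^ 3)] at key
    rw [integral_const_mul] at key
    have lhs : ∫ x, conjFundSol a τ e x * φ x =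
        ((τ : ℂ) ^ 3)⁻¹ * (τ * ∫ w, faddeevG w * pullback a τ e φ w) := by
      rw [← he.measurePreserving.integral_comp' (fun x => conjFundSol a τ e x * φ x),
        ← integral_const_mul]
      have e1 : ∀ w, conjFundSol a τ e (e w) * φ (e w) =
          (fun w => τ * (faddeevG w * pullback a τ e φ w)) (τ • w) := by
        intro w
        simp only [conjFundSol, pullback, e.symm_apply_apply, he.map_smul, smul_smul,
          inv_mul_cancel₀ hτ.ne', one_smul]
        ring
      simp_rw [e1]
      have : (volume : Measure (ℂ × ℝ)).IsAddHaarMeasure :=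
        inferInstanceAs ((volume : Measure ℂ).prod (volume : Measure ℝ)).IsAddHaarMeasure
      rw [Measure.integral_comp_smul volume (fun w => (τ : ℂ) * (faddeevG w * pullback a τ e φ w)),
        finrank_complex_prod_real, abs_of_pos (by positivity), Complex.real_smul]
      push_cast
      rfl
    have rhs : ∫ η, G η = (c : ℂ) ^ 3 * (((τ : ℂ) ^ 2)⁻¹ *
        ∫ q, (modelSymbol q)⁻¹ * (𝓕⁻ φ) (c • e q - (2 * Real.pi)⁻¹ • a)) := by
      rw [← integral_const_mul, ← integral_congr_ae (Eventually.of_forall (hG φ)),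
        he.measurePreserving.integral_comp' (fun x => G (c • x - (2 * Real.pi)⁻¹ • a)),
        Measure.integral_comp_smul volume (fun x => G (x - (2 * Real.pi)⁻¹ • a)),
        integral_sub_right_eq_self, finrank_R3, abs_of_pos (by positivity), Complex.real_smul]
      have : (c : ℂ) ≠ 0 := by exact_mod_cast hc0.ne'
      push_cast
      field_simp
    rw [lhs, rhs, key]
    have h1 : (τ : ℂ) ≠ 0 := by exact_mod_cast hτ.ne'
    have h2 : (Real.pi : ℂ) ≠ 0 := by exact_mod_cast hpi.ne'
    generalize ∫ q, (modelSymbol q)⁻¹ * (𝓕⁻ φ) (c • e q - (2 * Real.pi)⁻¹ • a) = J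
    rw [hc]
    push_cast
    field_simp

end Pairing

/-! ### Smallness of the Kato integrals -/

lemma ae_comp_sub_left {P : R3 → Prop} (h : ∀ᵐ u, P u) (x : R3) : ∀ᵐ y, P (x - y) :=
  (quasiMeasurePreserving_sub_left volume x).ae h

/-- The pair `(L, η)` depends only on `w`, `A` and `ε`: every kernel dominated by `A / |u|` whose
integral over the ball of radius `L` is at most `η` has small integrals against `w`. -/
lemma exists_lintegral_kernel_le_of_measurable {w : R3 → ℝ≥0∞} (hw : Measurable w)
    (hfin : ∀ y, w y ≠ ∞) (hint : ∫⁻ y, w y ≠ ∞)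
    (hkato : Tendsto (fun r : ℝ => ⨆ x : R3, ∫⁻ y in Metric.ball x r, w y / ‖x - y‖ₑ)
      (𝓝[>] 0) (𝓝 0)) {A : ℝ≥0∞} (hA : A ≠ ∞) {ε : ℝ≥0∞} (hε : ε ≠ 0) :
    ∃ L : ℝ, ∃ η : ℝ≥0∞, η ≠ 0 ∧ ∀ K : R3 → ℝ≥0∞, Measurable K → (∀ᵐ u, K u ≤ A / ‖u‖ₑ) →
      ∫⁻ u in Metric.ball 0 L, K u ≤ η → ∀ x, ∫⁻ y, K (x - y) * w y ≤ ε := by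
  have hε' : ε / 4 ≠ 0 := (ENNReal.div_pos hε (by simp)).ne'
  -- For `|x - y| < r` the Kato condition gives a bound that does not depend on the kernel.
  obtain ⟨r, hr, hr0⟩ : ∃ r : ℝ, (⨆ x : R3, ∫⁻ y in Metric.ball x r, w y / ‖x - y‖ₑ) ≤
      (ε / 4) / A ∧ 0 < r :=
    (((ENNReal.tendsto_nhds_zero.1 hkato) ((ε / 4) / A) (ENNReal.div_pos hε' hA)).and
      self_mem_nhdsWithin).exists
  -- For `|x - y| ≥ r` the kernel is at most `A / r`, and `w` is integrable on the set where it is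
  -- large.
  have hlarge : Tendsto (fun n : ℕ => A / ENNReal.ofReal r * ∫⁻ y in {y | (n : ℝ≥0∞) < w y}, w y)
      atTop (𝓝 0) := by
    have h1 : Tendsto (fun n : ℕ => ∫⁻ y in {y | (n : ℝ≥0∞) < w y}, w y) atTop (𝓝 0) := by
      have hm : ∀ n : ℕ, MeasurableSet {y | (n : ℝ≥0∞) < w y} := fun n =>
        measurableSet_lt measurable_const hw
      simp_rw [← lintegral_indicator (hm _)]
      rw [← lintegral_zero (α := R3) (μ := volume)]
      refine tendsto_lintegral_of_dominated_convergence w (fun n => hw.indicator (hm n))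
        (fun n => Eventually.of_forall fun y => Set.indicator_le_self _ _ _) hint
        (Eventually.of_forall fun y => ?_)
      obtain ⟨N, hN⟩ := ENNReal.exists_nat_gt (hfin y)
      refine tendsto_const_nhds.congr' ?_
      filter_upwards [eventually_ge_atTop N] with n hn
      refine (Set.indicator_of_notMem ?_ _).symm
      simp only [Set.mem_ofPred_eq, not_lt]
      exact hN.le.trans (by exact_mod_cast hn)
    have h2 := ENNReal.Tendsto.const_mul (a := A / ENNReal.ofReal r) h1
      (Or.inr (ENNReal.div_ne_top hA (by simpa using hr0)))
    simpa using h2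
  obtain ⟨n, hn⟩ := ((ENNReal.tendsto_nhds_zero.1 hlarge) (ε / 4) (pos_iff_ne_zero.2 hε')).exists
  -- For `|x - y| ≥ L` the kernel is at most `A / L`. What remains has `w ≤ n` and `|x - y| < L`.
  have hfar : Tendsto (fun L : ℝ => (A * ∫⁻ y, w y) / ENNReal.ofReal L) atTop (𝓝 0) := by
    have := ENNReal.Tendsto.const_div (a := A * ∫⁻ y, w y) ENNReal.tendsto_ofReal_atTop
      (Or.inr (ENNReal.mul_ne_top hA hint))
    simpa using this
  obtain ⟨L, hL⟩ := ((ENNReal.tendsto_nhds_zero.1 hfar) (ε / 4) (pos_iff_ne_zero.2 hε')).exists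
  refine ⟨L, (ε / 4) / n, (ENNReal.div_pos hε' (ENNReal.natCast_ne_top n)).ne',
    fun K hK hKA hKη x => ?_⟩
  have hpt : ∀ᵐ y, K (x - y) * w y ≤
      (Metric.ball x r).indicator (fun y => A * (w y / ‖x - y‖ₑ)) y +
      ({y | (n : ℝ≥0∞) < w y}.indicator (fun y => A / ENNReal.ofReal r * w y) y +
      ((Metric.ball x L).indicator (fun y => n * K (x - y)) y +
        A / ENNReal.ofReal L * w y)) := by
    filter_upwards [ae_comp_sub_left hKA x] with y hy
    by_cases h1 : y ∈ Metric.ball x r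
    · refine le_add_right ?_
      rw [Set.indicator_of_mem h1, ← mul_div_assoc, mul_comm A, mul_div_assoc, mul_comm]
      gcongr
    refine le_add_left ?_
    have h1' : ENNReal.ofReal r ≤ ‖x - y‖ₑ := by
      rw [← ofReal_norm]
      apply ENNReal.ofReal_le_ofReal
      rw [Metric.mem_ball, not_lt, dist_comm, dist_eq_norm] at h1
      exact h1
    by_cases h2 : (n : ℝ≥0∞) < w y
    · refine le_add_right ?_
      rw [Set.indicator_of_mem (show y ∈ {y | (n : ℝ≥0∞) < w y} from h2)]
      gcongr
      exact hy.trans (by gcongr)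
    refine le_add_left ?_
    by_cases h3 : y ∈ Metric.ball x L
    · refine le_add_right ?_
      rw [Set.indicator_of_mem h3, mul_comm]
      gcongr
      exact not_lt.1 h2
    refine le_add_left ?_
    have h3' : ENNReal.ofReal L ≤ ‖x - y‖ₑ := by
      rw [← ofReal_norm]
      apply ENNReal.ofReal_le_ofReal
      rw [Metric.mem_ball, not_lt, dist_comm, dist_eq_norm] at h3
      exact h3
    gcongr
    exact hy.trans (by gcongr)
  have hset : MeasurableSet {y | (n : ℝ≥0∞) < w y} := measurableSet_lt measurable_const hw
  refine (lintegral_mono_ae hpt).trans ?_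
  rw [lintegral_add_left, lintegral_add_left, lintegral_add_left,
    lintegral_indicator measurableSet_ball, lintegral_indicator hset,
    lintegral_indicator measurableSet_ball, lintegral_const_mul _ hw, lintegral_const_mul _ hw,
    lintegral_const_mul, lintegral_const_mul]
  · have b1 : A * ∫⁻ y in Metric.ball x r, w y / ‖x - y‖ₑ ≤ ε / 4 := by
      refine le_trans ?_ (ENNReal.mul_div_le (a := A))
      gcongr
      exact (le_iSup (fun x => ∫⁻ y in Metric.ball x r, w y / ‖x - y‖ₑ) x).trans hr
    have b3 : n * ∫⁻ y in Metric.ball x L, K (x - y) ≤ ε / 4 := by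
      refine le_trans ?_ (ENNReal.mul_div_le (a := (n : ℝ≥0∞)))
      gcongr
      refine le_trans (le_of_eq ?_) hKη
      rw [← lintegral_indicator measurableSet_ball, ← lintegral_indicator measurableSet_ball,
        ← lintegral_sub_left_eq_self ((Metric.ball 0 L).indicator K) x]
      refine lintegral_congr fun y => ?_
      have : y ∈ Metric.ball x L ↔ x - y ∈ Metric.ball 0 L := by
        rw [Metric.mem_ball, mem_ball_zero_iff, dist_comm, dist_eq_norm]
      by_cases h : y ∈ Metric.ball x L
      · rw [Set.indicator_of_mem h, Set.indicator_of_mem (this.1 h)]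
      · rw [Set.indicator_of_notMem h, Set.indicator_of_notMem (fun h' => h (this.2 h'))]
    have b4 : A / ENNReal.ofReal L * ∫⁻ y, w y ≤ ε / 4 := by
      refine le_trans (le_of_eq ?_) hL
      rw [ENNReal.div_eq_inv_mul, ENNReal.div_eq_inv_mul, mul_assoc]
    calc _ ≤ ε / 4 + (ε / 4 + (ε / 4 + ε / 4)) := by gcongr
      _ = ε := by
        rw [← add_assoc, ← add_assoc, ← mul_one (ε / 4), ← mul_add, ← mul_add, ← mul_add]
        norm_num
        exact ENNReal.div_mul_cancel (by simp) (by simp)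
  all_goals first
    | fun_prop
    | exact Measurable.indicator (by fun_prop) measurableSet_ball

lemma exists_lintegral_kernel_le {W : R3 → ℂ} (hW : IsKato W) (hWi : Integrable W) {A : ℝ≥0∞}
    (hA : A ≠ ∞) {ε : ℝ≥0∞} (hε : ε ≠ 0) :
    ∃ L : ℝ, ∃ η : ℝ≥0∞, η ≠ 0 ∧ ∀ K : R3 → ℝ≥0∞, Measurable K → (∀ᵐ u, K u ≤ A / ‖u‖ₑ) →
      ∫⁻ u in Metric.ball 0 L, K u ≤ η → ∀ x, ∫⁻ y, K (x - y) * ‖W y‖ₑ ≤ ε := by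
  have hae := hWi.1.ae_eq_mk
  set W' := hWi.1.mk W
  have hW' : Measurable W' := hWi.1.stronglyMeasurable_mk.measurable
  obtain ⟨L, η, hη, h⟩ := exists_lintegral_kernel_le_of_measurable (w := fun y => ‖W' y‖ₑ)
    hW'.enorm (fun y => enorm_ne_top) (hWi.congr hae).2.ne (by
      refine hW.2.congr fun r => iSup_congr fun x => ?_
      refine lintegral_congr_ae (ae_restrict_of_ae ?_)
      filter_upwards [hae] with y hy
      rw [hy]) hA hε
  refine ⟨L, η, hη, fun K hK hKA hKη x => ?_⟩
  refine le_trans (le_of_eq (lintegral_congr_ae ?_)) (h K hK hKA hKη x)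
  filter_upwards [hae] with y hy
  rw [hy]

/-- Uniform smallness in the base point, the modulation and the frame. -/
lemma exists_lintegral_conjFundSol_le {W : R3 → ℂ} (hW : IsKato W) (hWi : Integrable W)
    {ε : ℝ≥0∞} (hε : ε ≠ 0) : ∃ τ₀ : ℝ, 0 < τ₀ ∧ ∀ τ ≥ τ₀, ∀ (a ω : R3) (e : (ℂ × ℝ) ≃ᵐ R3),
      IsFrame ω e → (∀ x, ∫⁻ y, ‖conjFundSol a τ e (x - y)‖ₑ * ‖W y‖ₑ ≤ ε) ∧
        ∀ x, ∫⁻ y, ‖conjFundSol a τ e (y - x)‖ₑ * ‖W y‖ₑ ≤ ε := by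
  obtain ⟨L, η, hη, h⟩ := exists_lintegral_kernel_le hW hWi (A := ENNReal.ofReal 100) (by simp) hε
  obtain ⟨τ₀, hτ₀⟩ := eventually_atTop.1 ((ENNReal.tendsto_nhds_zero.1
    (tendsto_lintegral_faddeevG L)) η (pos_iff_ne_zero.2 hη))
  refine ⟨max τ₀ 1, by positivity, fun τ hτ a ω e he => ?_⟩
  have hτ1 : 0 < τ := lt_of_lt_of_le (by positivity) hτ
  have hm := measurable_conjFundSol a τ e
  have hb : ∀ᵐ u : R3, ‖conjFundSol a τ e u‖ₑ ≤ ENNReal.ofReal 100 / ‖u‖ₑ := by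
    have h0 : ∀ᵐ u : R3, u ≠ 0 := by simp [ae_iff, measure_singleton]
    filter_upwards [norm_conjFundSol_le he a hτ1, h0] with u hu hu0
    rw [← ofReal_norm, ← ofReal_norm, ← ENNReal.ofReal_div_of_pos (norm_pos_iff.2 hu0)]
    exact ENNReal.ofReal_le_ofReal hu
  have hball : ∫⁻ u in Metric.ball 0 L, ‖conjFundSol a τ e u‖ₑ ≤ η := by
    refine le_trans (le_of_eq ?_) (hτ₀ τ ((le_max_left _ _).trans hτ))
    have hpre : {w | cylNorm w < L} = e ⁻¹' Metric.ball 0 L := by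
      ext w
      rw [Set.mem_preimage, mem_ball_zero_iff, he.norm_map]
      rfl
    rw [hpre, ← he.measurePreserving.setLIntegral_comp_preimage_emb e.measurableEmbedding]
    refine lintegral_congr fun w => ?_
    rw [← ofReal_norm, norm_conjFundSol, ofReal_norm, e.symm_apply_apply]
  refine ⟨h _ hm.enorm hb hball, fun x => ?_⟩
  have hneg : ∫⁻ u in Metric.ball 0 L, ‖conjFundSol a τ e (-u)‖ₑ ≤ η := by
    refine le_trans (le_of_eq ?_) hball
    have hpre : Metric.ball (0 : R3) L = Neg.neg ⁻¹' Metric.ball 0 L := by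
      ext u; simp
    conv_lhs => rw [hpre]
    exact (Measure.measurePreserving_neg volume).setLIntegral_comp_preimage_emb
      (MeasurableEquiv.neg R3).measurableEmbedding (fun u => ‖conjFundSol a τ e u‖ₑ) _
  have hb' : ∀ᵐ u : R3, ‖conjFundSol a τ e (-u)‖ₑ ≤ ENNReal.ofReal 100 / ‖u‖ₑ := by
    filter_upwards [(Measure.measurePreserving_neg volume).quasiMeasurePreserving.ae hb] with u hu
    simpa using hu
  have := h (fun u => ‖conjFundSol a τ e (-u)‖ₑ) (hm.comp measurable_neg).enorm hb' hneg x
  simpa using this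

/-! ### Integrability of the potentials -/

/-- By the Lindelöf property the function vanishes almost everywhere off its essential support. -/
lemma integrable_of_essSupport_subset {V : R3 → ℂ} (hV : LocallyIntegrable V) {U : Set R3}
    (hU : Bornology.IsBounded U) (hVU : essSupport V ⊆ U) : Integrable V := by
  have hnull : volume {y | y ∉ essSupport V ∧ V y ≠ 0} = 0 := by
    refine measure_null_of_locally_null _ fun x hx => ?_
    obtain ⟨hx1, -⟩ := hx
    simp only [essSupport, Set.mem_ofPred_eq, not_forall, not_not] at hx1
    obtain ⟨r, hr, h⟩ := hx1
    refine ⟨_, inter_mem_nhdsWithin _ (Metric.ball_mem_nhds x hr), ?_⟩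
    rw [ae_restrict_iff' measurableSet_ball, ae_iff] at h
    refine measure_mono_null (fun y hy => ?_) h
    simp only [Set.mem_ofPred_eq, Classical.not_imp]
    exact ⟨hy.2, hy.1.2⟩
  have hK : IntegrableOn V (closure U) := hV.integrableOn_isCompact hU.isCompact_closure
  refine hK.integrable_of_ae_notMem_eq_zero ?_
  rw [ae_iff]
  refine measure_mono_null (fun y hy => ?_) hnull
  simp only [Set.mem_ofPred_eq, Classical.not_imp] at hy
  exact ⟨fun h => hy.1 (subset_closure (hVU h)), hy.2⟩

/-! ### Schur's test -/

lemma enorm_sqrt_norm_sq (x : ℂ) : ‖((Real.sqrt ‖x‖ : ℝ) : ℂ)‖ₑ ^ 2 = ‖x‖ₑ := by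
  rw [← ofReal_norm, ← ENNReal.ofReal_pow (norm_nonneg _), Complex.norm_real,
    Real.norm_of_nonneg (Real.sqrt_nonneg _), Real.sq_sqrt (norm_nonneg _), ofReal_norm]

lemma aestronglyMeasurable_sqrt_norm {W : R3 → ℂ} (hW : AEStronglyMeasurable W) :
    AEStronglyMeasurable fun y => ((Real.sqrt ‖W y‖ : ℝ) : ℂ) :=
  (by fun_prop : Continuous fun x : ℂ => ((Real.sqrt ‖x‖ : ℝ) : ℂ)).comp_aestronglyMeasurable hW

lemma aestronglyMeasurable_sqrtMul {W f : R3 → ℂ} (hW : AEStronglyMeasurable W)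
    (hf : AEStronglyMeasurable f) : AEStronglyMeasurable (sqrtMul W f) :=
  (aestronglyMeasurable_sqrt_norm hW).mul hf

lemma integrable_sqrtMul {W f : R3 → ℂ} (hW : Integrable W) (hf : MemLp f 2) :
    Integrable (sqrtMul W f) := by
  have h : MemLp (fun y => ((Real.sqrt ‖W y‖ : ℝ) : ℂ)) 2 := by
    rw [memLp_two_iff_integrable_sq_norm (aestronglyMeasurable_sqrt_norm hW.1)]
    refine hW.norm.congr (Eventually.of_forall fun y => ?_)
    simp only
    rw [Complex.norm_real, Real.norm_of_nonneg (Real.sqrt_nonneg _), Real.sq_sqrt (norm_nonneg _)]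
  exact h.integrable_mul hf

/-- Inside the unit ball the kernel is integrable, and outside it is bounded. -/
lemma ae_convolutionExistsAt_of_norm_le_inv {E g : R3 → ℂ} (hE : AEStronglyMeasurable E) {A : ℝ}
    (hA : ∀ᵐ x : R3, ‖E x‖ ≤ A / ‖x‖) (hg : Integrable g) :
    ∀ᵐ x : R3, ConvolutionExistsAt E g x (ContinuousLinearMap.mul ℂ ℂ) volume := by
  have h1 : Integrable ((Metric.ball (0 : R3) 1).indicator E) := by
    rw [integrable_indicator_iff measurableSet_ball]
    exact ((locallyIntegrable_of_norm_le_inv hE hA).integrableOn_isCompact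
      (isCompact_closedBall 0 1)).mono_set Metric.ball_subset_closedBall
  filter_upwards [h1.ae_convolution_exists (ContinuousLinearMap.mul ℂ ℂ) hg] with x hx
  have h2 : Integrable fun t => (Metric.ball (0 : R3) 1)ᶜ.indicator E t * g (x - t) := by
    refine (hg.comp_sub_left x).bdd_mul (c := |A|)
      (hE.indicator measurableSet_ball.compl) ?_
    filter_upwards [hA] with t ht
    by_cases h : t ∈ (Metric.ball (0 : R3) 1)ᶜ
    · rw [Set.indicator_of_mem h]
      rw [Set.mem_compl_iff, mem_ball_zero_iff, not_lt] at h
      refine ht.trans ?_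
      rw [div_le_iff₀ (by linarith)]
      exact (le_abs_self A).trans (le_mul_of_one_le_right (abs_nonneg A) h)
    · rw [Set.indicator_of_notMem h, norm_zero]; positivity
  refine (Integrable.add hx h2).congr (Eventually.of_forall fun t => ?_)
  simp only [Pi.add_apply, ContinuousLinearMap.mul_apply']
  rw [← add_mul]
  congr 1
  by_cases h : t ∈ Metric.ball (0 : R3) 1 <;> simp [h]

/-- The Cauchy-Schwarz inequality for the measure with density `k²`. -/
lemma lintegral_mul_sq_le {k a b : R3 → ℝ≥0∞} (ha : AEMeasurable a) (hb : AEMeasurable b)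
    (hk : AEMeasurable k) :
    (∫⁻ y, k y ^ 2 * (a y * b y)) ^ 2 ≤ (∫⁻ y, k y ^ 2 * a y ^ 2) * ∫⁻ y, k y ^ 2 * b y ^ 2 := by
  have h := ENNReal.lintegral_mul_le_Lp_mul_Lq volume (p := 2) (q := 2)
    (by rw [Real.holderConjugate_iff]; norm_num) (hk.mul ha) (hk.mul hb)
  have e : ∀ y, ((k * a) * (k * b)) y = k y ^ 2 * (a y * b y) := fun y => by
    simp only [Pi.mul_apply]; ring
  simp_rw [e, ENNReal.rpow_two, Pi.mul_apply, mul_pow] at h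
  calc _ ≤ ((∫⁻ y, k y ^ 2 * a y ^ 2) ^ (1 / (2:ℝ)) *
        (∫⁻ y, k y ^ 2 * b y ^ 2) ^ (1 / (2:ℝ))) ^ 2 := by gcongr
    _ = _ := by
      rw [mul_pow, ← ENNReal.rpow_two, ← ENNReal.rpow_two, ← ENNReal.rpow_mul,
        ← ENNReal.rpow_mul]
      norm_num

/-- Schur's test. -/
lemma lintegral_schur_le {E V W f : R3 → ℂ} (hE : Measurable E) (hV : AEStronglyMeasurable V)
    (hW : AEStronglyMeasurable W) (hf : AEStronglyMeasurable f) {d : ℝ≥0∞}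
    (h1 : ∀ x, ∫⁻ y, ‖E (x - y)‖ₑ * ‖W y‖ₑ ≤ d) (h2 : ∀ y, ∫⁻ x, ‖E (x - y)‖ₑ * ‖V x‖ₑ ≤ d) :
    ∫⁻ x, ‖V x‖ₑ * (∫⁻ y, ‖E (x - y)‖ₑ * ‖sqrtMul W f y‖ₑ) ^ 2 ≤ d ^ 2 * ∫⁻ y, ‖f y‖ₑ ^ 2 := by
  have hpt : ∀ x, (∫⁻ y, ‖E (x - y)‖ₑ * ‖sqrtMul W f y‖ₑ) ^ 2 ≤
      d * ∫⁻ y, ‖E (x - y)‖ₑ * ‖f y‖ₑ ^ 2 := by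
    intro x
    have h := lintegral_mul_sq_le (k := fun y => ‖((Real.sqrt ‖E (x - y)‖ : ℝ) : ℂ)‖ₑ)
      (a := fun y => ‖((Real.sqrt ‖W y‖ : ℝ) : ℂ)‖ₑ) (b := fun y => ‖f y‖ₑ)
      (aestronglyMeasurable_sqrt_norm hW).enorm hf.enorm (by fun_prop)
    simp_rw [enorm_sqrt_norm_sq] at h
    simp_rw [sqrtMul, enorm_mul]
    exact h.trans (by gcongr; exact h1 x)
  have hm : AEMeasurable (Function.uncurry fun x y : R3 => ‖V x‖ₑ * (‖E (x - y)‖ₑ * ‖f y‖ₑ ^ 2))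
      (volume.prod volume) := by
    have m1 : AEMeasurable (fun p : R3 × R3 => ‖V p.1‖ₑ) (volume.prod volume) := hV.enorm.comp_fst
    have m2 : AEMeasurable (fun p : R3 × R3 => ‖f p.2‖ₑ) (volume.prod volume) := hf.enorm.comp_snd
    have m3 : AEMeasurable (fun p : R3 × R3 => ‖E (p.1 - p.2)‖ₑ) (volume.prod volume) :=
      (hE.comp (measurable_fst.sub measurable_snd)).enorm.aemeasurable
    exact m1.mul (m3.mul (m2.pow_const 2))
  calc _ ≤ ∫⁻ x, ‖V x‖ₑ * (d * ∫⁻ y, ‖E (x - y)‖ₑ * ‖f y‖ₑ ^ 2) := by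
        gcongr with x; exact hpt x
    _ = ∫⁻ x, d * ∫⁻ y, ‖V x‖ₑ * (‖E (x - y)‖ₑ * ‖f y‖ₑ ^ 2) := by
        refine lintegral_congr fun x => ?_
        rw [lintegral_const_mul' _ _ enorm_ne_top, mul_left_comm]
    _ = d * ∫⁻ x, ∫⁻ y, ‖V x‖ₑ * (‖E (x - y)‖ₑ * ‖f y‖ₑ ^ 2) :=
        lintegral_const_mul'' _ hm.lintegral_prod_right'
    _ = d * ∫⁻ y, ∫⁻ x, ‖V x‖ₑ * (‖E (x - y)‖ₑ * ‖f y‖ₑ ^ 2) := by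
        rw [lintegral_lintegral_swap hm]
    _ = d * ∫⁻ y, (∫⁻ x, ‖E (x - y)‖ₑ * ‖V x‖ₑ) * ‖f y‖ₑ ^ 2 := by
        congr 1
        refine lintegral_congr fun y => ?_
        rw [← lintegral_mul_const' _ _ (by simp)]
        refine lintegral_congr fun x => ?_
        ring
    _ ≤ d * ∫⁻ y, d * ‖f y‖ₑ ^ 2 := by gcongr with y; exact h2 y
    _ = d * (d * ∫⁻ y, ‖f y‖ₑ ^ 2) := by
        rw [lintegral_const_mul'' _ (hf.enorm.pow_const 2)]
    _ = _ := by ring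

lemma eLpNorm_two_le_of_lintegral_sq_le {f g : R3 → ℂ} {d : ℝ≥0∞}
    (h : ∫⁻ x, ‖g x‖ₑ ^ 2 ≤ d ^ 2 * ∫⁻ x, ‖f x‖ₑ ^ 2) : eLpNorm g 2 ≤ d * eLpNorm f 2 := by
  have e : ∀ u : R3 → ℂ, eLpNorm u 2 ^ 2 = ∫⁻ x, ‖u x‖ₑ ^ 2 := fun u => by
    have := eLpNorm_nnreal_pow_eq_lintegral (μ := volume) (f := u) (p := 2) (by norm_num)
    simpa using this
  rw [← e, ← e, ← mul_pow] at h
  exact (ENNReal.pow_le_pow_left_iff two_ne_zero).1 h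

/-! ### The operator -/

section Sandwich

variable {E V W : R3 → ℂ} {δ : ℝ}

/-- The function `|V|^{1/2} (E * (|W|^{1/2} f))`. -/
noncomputable def sandwichFun (E V W f : R3 → ℂ) : R3 → ℂ :=
  sqrtMul V (E ⋆[ContinuousLinearMap.mul ℂ ℂ, volume] (sqrtMul W f))

lemma aestronglyMeasurable_sandwichFun (hE : Measurable E) (hV : AEStronglyMeasurable V)
    (hW : AEStronglyMeasurable W) {f : R3 → ℂ} (hf : AEStronglyMeasurable f) :
    AEStronglyMeasurable (sandwichFun E V W f) := by
  refine aestronglyMeasurable_sqrtMul hV ?_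
  have := hE.aestronglyMeasurable.convolution_integrand (μ := volume) (ν := volume)
    (ContinuousLinearMap.mul ℂ ℂ) (aestronglyMeasurable_sqrtMul hW hf)
  exact this.integral_prod_right'

lemma eLpNorm_sandwichFun_le (hE : Measurable E) (hV : AEStronglyMeasurable V)
    (hW : AEStronglyMeasurable W) {f : R3 → ℂ} (hf : AEStronglyMeasurable f) {d : ℝ≥0∞}
    (h1 : ∀ x, ∫⁻ y, ‖E (x - y)‖ₑ * ‖W y‖ₑ ≤ d) (h2 : ∀ y, ∫⁻ x, ‖E (x - y)‖ₑ * ‖V x‖ₑ ≤ d) :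
    eLpNorm (sandwichFun E V W f) 2 ≤ d * eLpNorm f 2 := by
  refine eLpNorm_two_le_of_lintegral_sq_le (le_trans ?_ (lintegral_schur_le hE hV hW hf h1 h2))
  gcongr with x
  rw [sandwichFun, sqrtMul, enorm_mul, mul_pow, enorm_sqrt_norm_sq, convolution_eq_swap]
  gcongr
  refine (enorm_integral_le_lintegral_enorm _).trans (le_of_eq ?_)
  simp

theorem exists_isSandwich {z : C3} (hδ : 0 ≤ δ) (hE : Measurable E) (hF : IsFundSol z E) {A : ℝ}
    (hA : ∀ᵐ x : R3, ‖E x‖ ≤ A / ‖x‖) (hV : Integrable V) (hW : Integrable W)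
    (h1 : ∀ x, ∫⁻ y, ‖E (x - y)‖ₑ * ‖W y‖ₑ ≤ ENNReal.ofReal δ)
    (h2 : ∀ y, ∫⁻ x, ‖E (x - y)‖ₑ * ‖V x‖ₑ ≤ ENNReal.ofReal δ) :
    ∃ T : L2R3 →L[ℂ] L2R3, IsSandwich z V W T ∧ ‖T‖ ≤ δ := by
  have hex : ∀ f : L2R3, ∀ᵐ x : R3, ConvolutionExistsAt E (sqrtMul W f) x
      (ContinuousLinearMap.mul ℂ ℂ) volume := fun f =>
    ae_convolutionExistsAt_of_norm_le_inv hE.aestronglyMeasurable hA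
      (integrable_sqrtMul hW (Lp.memLp f))
  have hle : ∀ f : L2R3, eLpNorm (sandwichFun E V W f) 2 ≤ ENNReal.ofReal δ * eLpNorm f 2 :=
    fun f => eLpNorm_sandwichFun_le hE hV.1 hW.1 (Lp.aestronglyMeasurable f) h1 h2
  have hmem : ∀ f : L2R3, MemLp (sandwichFun E V W f) 2 := fun f =>
    ⟨aestronglyMeasurable_sandwichFun hE hV.1 hW.1 (Lp.aestronglyMeasurable f),
      (hle f).trans_lt (ENNReal.mul_lt_top ENNReal.ofReal_lt_top (Lp.memLp f).2)⟩
  let T₀ : L2R3 →ₗ[ℂ] L2R3 :=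
    { toFun := fun f => (hmem f).toLp _
      map_add' := fun f g => by
        apply Lp.ext
        filter_upwards [(hmem (f + g)).coeFn_toLp, (hmem f).coeFn_toLp, (hmem g).coeFn_toLp,
          Lp.coeFn_add ((hmem f).toLp _) ((hmem g).toLp _), hex f, hex g] with x e1 e2 e3 e4 x1 x2
        rw [e1, e4, Pi.add_apply, e2, e3]
        have hc : sqrtMul W (f + g : L2R3) =ᵐ[volume] sqrtMul W f + sqrtMul W g := by
          filter_upwards [Lp.coeFn_add f g] with y hy
          simp only [sqrtMul, hy, Pi.add_apply, mul_add]
        simp only [sandwichFun, sqrtMul] at *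
        rw [convolution_congr _ (EventuallyEq.refl _ E) hc, x1.distrib_add x2, mul_add]
      map_smul' := fun c f => by
        apply Lp.ext
        filter_upwards [(hmem (c • f)).coeFn_toLp, (hmem f).coeFn_toLp,
          Lp.coeFn_smul c ((hmem f).toLp _)] with x e1 e2 e3
        rw [e1, RingHom.id_apply, e3, Pi.smul_apply, e2]
        have hc : sqrtMul W (c • f : L2R3) =ᵐ[volume] c • sqrtMul W f := by
          filter_upwards [Lp.coeFn_smul c f] with y hy
          simp only [sqrtMul, hy, Pi.smul_apply, smul_eq_mul]
          ring
        simp only [sandwichFun, sqrtMul] at *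
        rw [convolution_congr _ (EventuallyEq.refl _ E) hc, convolution_smul, Pi.smul_apply,
          smul_eq_mul, smul_eq_mul]
        ring }
  have hT₀ : ∀ f, ‖T₀ f‖ ≤ δ * ‖f‖ := fun f => by
    change ‖(hmem f).toLp _‖ ≤ _
    rw [Lp.norm_toLp, Lp.norm_def, ← ENNReal.toReal_ofReal hδ, ← ENNReal.toReal_mul]
    refine ENNReal.toReal_mono (ENNReal.mul_ne_top ENNReal.ofReal_ne_top (Lp.eLpNorm_ne_top f)) ?_
    simpa [ENNReal.toReal_ofReal hδ] using hle f
  refine ⟨T₀.mkContinuous δ hT₀, ⟨E, hF, fun f => ⟨hex f, (hmem f).coeFn_toLp⟩⟩,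
    LinearMap.mkContinuous_norm_le _ hδ _⟩

end Sandwich

theorem lemma3p4 (V W : R3 → ℂ) (hV : IsKato V) (hW : IsKato W) (δ : ℝ) (hδ : 0 < δ) :
    ∃ s₀ : ℝ, 0 < s₀ ∧
      ∀ U : Set R3, IsOpen U → Bornology.IsBounded U →
        essSupport V ⊆ U → essSupport W ⊆ U →
        ∀ z : C3, s₀ ≤ ‖z‖ → bilinSq z = 0 →
          ∃ T : L2R3 →L[ℂ] L2R3, IsSandwich z V W T ∧ ‖T‖ ≤ δ := by
  by_cases hi : Integrable V ∧ Integrable W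
  · obtain ⟨hVi, hWi⟩ := hi
    have hδ' : ENNReal.ofReal δ ≠ 0 := by simpa using hδ
    obtain ⟨τV, hτV, HV⟩ := exists_lintegral_conjFundSol_le hV hVi hδ'
    obtain ⟨τW, -, HW⟩ := exists_lintegral_conjFundSol_le hW hWi hδ'
    have hs : 0 < Real.sqrt 2 := by positivity
    refine ⟨max τV τW * Real.sqrt 2, mul_pos (lt_max_of_lt_left hτV) hs,
      fun U _ _ _ _ z hz hz0 => ?_⟩
    set τ := ‖z‖ / Real.sqrt 2 with hτ
    have hτm : max τV τW ≤ τ := (le_div_iff₀ hs).2 hz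
    have hτ0 : 0 < τ := (lt_max_of_lt_left hτV).trans_le hτm
    obtain ⟨e, he⟩ := exists_isFrame (ω := τ⁻¹ • imPart z) (by
      rw [norm_smul, norm_imPart_of_bilinSq hz0, ← hτ, norm_inv, Real.norm_of_nonneg hτ0.le,
        inv_mul_cancel₀ hτ0.ne'])
    exact exists_isSandwich hδ.le (measurable_conjFundSol (rePart z) τ e)
      (isFundSol_conjFundSol hz0 hτ0 (norm_rePart_of_bilinSq hz0) he)
      (norm_conjFundSol_le he _ hτ0) hVi hWi
      (HW τ ((le_max_right _ _).trans hτm) (rePart z) _ e he).1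
      (HV τ ((le_max_left _ _).trans hτm) (rePart z) _ e he).2
  -- If `V` or `W` is not integrable, no bounded set contains both supports.
  · exact ⟨1, one_pos, fun U _ hU hVU hWU => absurd
      ⟨integrable_of_essSupport_subset hV.1 hU hVU, integrable_of_essSupport_subset hW.1 hU hWU⟩ hi⟩
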